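/- Let $(X,\mathfrak M,\mu)$ be a measure space. A family $\mathfrak B\subset\mathfrak M$ (its members are called balls) is a ball-basis with constant $\mathcal K$ if: (B1) $0<\mu(B)<\infty$ for every $B\in\mathfrak B$; (B2) for any $x,y\in X$ there is a ball containing $x$ and $y$; (B3) for every $E\in\mathfrak M$ and $\varepsilon>0$ there is a finite (possibly empty) or infinite sequence of balls $B_k$ with $\mu(E\,\triangle\,\bigcup_k B_k)<\varepsilon$; (B4) every ball $B$ has a hull $B^*\in\mathfrak B$ such that $A\subset B^*$ for every ball $A$ with $\mu(A)\le 2\mu(B)$ and $A\cap B\ne\varnothing$, and $\mu(B^*)\le\mathcal K\mu(B)$. A choice of the hulls is fixed. Let $1\le r<\infty$. For real $f\in L^r(X)$ and a ball $B$ put $\langle f\rangle_{B,r}=\big(\frac1{\mu(B)}\int_B|f|^r\,d\mu\big)^{1/r}$ and $\langle f\rangle^*_{B,r}=\sup_{A\in\mathfrak B,\,A\supset B}\langle f\rangle_{A,r}$. An operator $T$ from $L^r(X)$ to the real functions on $X$ (not necessarily measurable) is subadditive if $|T(\lambda f)(x)|=|\lambda|\,|Tf(x)|$ and $|T(f+g)(x)|\le|Tf(x)|+|Tg(x)|$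 for all $f,g\in L^r(X)$, $\lambda\in\mathbb R$, $x\in X$. It is a bounded oscillation operator with respect to $\mathfrak B$ if it is subadditive and the following two constants are finite (with $0/0=0$): $$\mathcal L_1=\sup_{B\in\mathfrak B}\ \sup_{x,x'\in B,\ f\in L^r(X)}\frac{|T(f\mathbf 1_{X\setminus B^*})(x)-T(f\mathbf 1_{X\setminus B^*})(x')|}{\langle f\rangle^*_{B,r}},$$ and $\mathcal L_2$, the infimum of all $L\in[0,\infty]$ such that for every ball $A$ with $A^*\ne X$ there is a ball $B\supsetneq A$ with $$\sup_{x\in A,\ f\in L^r(X)}\frac{|T(f\mathbf 1_{B^*\setminus A^*})(x)|}{\langle f\rangle_{B^*,r}}\le L.$$ With $\mu^*$ the outer measure of $\mu$, put $\|T\|_{L^r\to L^{r,\infty}}=\sup_{t>0,\,f\in L^r(X)} t\,\mu^*\{|Tf|>t\}^{1/r}/\|f\|_{L^r}$. A collection $\mathcal S\subset\mathfrak B$ is $\gamma$-sparse if there are pairwise disjoint measurable sets $E_B\subset B$ $(B\in\mathcal S)$ with $\mu(E_B)\ge\gamma\mu(B)$. For $\mathcal S\subset\mathfrak B$ put $\mathcal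 A_{\mathcal S,r}f(x)=\sum_{A\in\mathcal S}\langle f\rangle_{A,r}\mathbf 1_A(x)\in[0,\infty]$. **Theorem.** For every $\mathcal K$ there are constants $C>0$ and $0<\gamma<1$, depending only on $\mathcal K$, such that the following holds. Let $\mathfrak B$ be a ball-basis with constant $\mathcal K$ of a measure space $(X,\mathfrak M,\mu)$, let $1\le r<\infty$, and let $T$ be a bounded oscillation operator on $L^r(X)$ with respect to $\mathfrak B$ with $\|T\|_{L^r\to L^{r,\infty}}<\infty$. Then for every $f\in L^r(X)$ and every ball $B\in\mathfrak B$ there is a family of balls $\mathcal S\subset\mathfrak B$ that is a union of two $\gamma$-sparse collections and satisfies $$|Tf(x)|\le C\,\big(\mathcal L_1+\mathcal L_2+\|T\|_{L^r\to L^{r,\infty}}\big)\,\mathcal A_{\mathcal S,r}f(x)\quad\text{for a.e. }x\in B.$$ -/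

import Mathlib

open MeasureTheory Set
open scoped ENNReal NNReal

noncomputable section

/-- A ball-basis with constant `K` of the measure space `(X, μ)`, together with a choice of the
hull of every ball. The sequence in `exists_approx` is finite (possibly empty) or infinite. -/
structure BallBasis {X : Type*} [MeasurableSpace X] (μ : Measure X) (K : ℝ≥0) where
  /-- the family of balls -/
  balls : Set (Set X)
  /-- the hull `B*` of a ball `B` -/
  hull : balls → balls
  measurableSet : ∀ B ∈ balls, MeasurableSet B
  measure_pos : ∀ B ∈ balls, 0 < μ B
  measure_lt_top : ∀ B ∈ balls, μ B < ∞
  exists_mem_mem : ∀ x y : X, ∃ B ∈ balls, x ∈ B ∧ y ∈ B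
  exists_approx : ∀ E : Set X, MeasurableSet E → ∀ ε : ℝ≥0∞, 0 < ε →
    ∃ G : Set (Set X), G ⊆ balls ∧ G.Countable ∧ μ (symmDiff E (⋃₀ G)) < ε
  subset_hull : ∀ B : balls,
    (⋃₀ {A : Set X | A ∈ balls ∧ μ A ≤ 2 * μ (B : Set X) ∧ (A ∩ (B : Set X)).Nonempty})
      ⊆ (hull B : Set X)
  measure_hull_le : ∀ B : balls, μ (hull B : Set X) ≤ K * μ (B : Set X)

section Operators

variable {X : Type*} [MeasurableSpace X] {μ : Measure X} {K r : ℝ≥0}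

/-- The product `f · 1_E` of `f ∈ L^r` with the indicator of a measurable set `E`. -/
def cutoff (f : Lp ℝ r μ) {E : Set X} (hE : MeasurableSet E) : Lp ℝ r μ :=
  ((Lp.memLp f).indicator hE).toLp (E.indicator f)

/-- `⟨f⟩_{B,r} = (μ(B)⁻¹ ∫_B |f|^r)^{1/r}`. -/
def avg (f : Lp ℝ r μ) (B : Set X) : ℝ≥0∞ :=
  ((μ B)⁻¹ * ∫⁻ x in B, ‖f x‖ₑ ^ (r : ℝ) ∂μ) ^ (1 / (r : ℝ))

/-- An operator from `L^r` to the (everywhere defined, possibly non-measurable) functions on `X`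
is subadditive. -/
structure IsSubadditiveOp (T : Lp ℝ r μ → X → ℝ) : Prop where
  abs_smul : ∀ (c : ℝ) (f : Lp ℝ r μ) (x : X), |T (c • f) x| = |c| * |T f x|
  abs_add_le : ∀ (f g : Lp ℝ r μ) (x : X), |T (f + g) x| ≤ |T f x| + |T g x|

/-- `‖T‖_{L^r → L^{r,∞}} = sup_{t > 0, f} t · μ*{|Tf| > t}^{1/r} / ‖f‖_r`. A `Measure` is defined on
all sets, and its value on a non-measurable set is the outer measure. -/
def weakNorm (T : Lp ℝ r μ → X → ℝ) : ℝ≥0∞ :=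
  ⨆ (t : ℝ≥0) (_ : 0 < t) (f : Lp ℝ r μ),
    (t : ℝ≥0∞) * μ {x | (t : ℝ) < |T f x|} ^ (1 / (r : ℝ)) / eLpNorm f r μ

namespace BallBasis

variable (𝓑 : BallBasis μ K)

/-- `⟨f⟩*_{B,r}`: the supremum of `⟨f⟩_{A,r}` over all balls `A ⊇ B`. -/
def avgStar (f : Lp ℝ r μ) (B : 𝓑.balls) : ℝ≥0∞ :=
  ⨆ (A : 𝓑.balls) (_ : (B : Set X) ⊆ A), avg f (A : Set X)

theorem measurableSet_hull (B : 𝓑.balls) : MeasurableSet (𝓑.hull B : Set X) :=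
  𝓑.measurableSet _ (𝓑.hull B).2

/-- The localization constant of `T`: the supremum, over all balls `B`, points `x, x' ∈ B` and
`f ∈ L^r`, of `|T(f·1_{X∖B*})(x) - T(f·1_{X∖B*})(x')| / ⟨f⟩*_{B,r}`. -/
def locConst (T : Lp ℝ r μ → X → ℝ) : ℝ≥0∞ :=
  ⨆ (B : 𝓑.balls) (x ∈ (B : Set X)) (x' ∈ (B : Set X)) (f : Lp ℝ r μ),
    ‖T (cutoff f (𝓑.measurableSet_hull B).compl) x
        - T (cutoff f (𝓑.measurableSet_hull B).compl) x'‖ₑ / 𝓑.avgStar f B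

/-- The supremum, over `x ∈ A` and `f ∈ L^r`, of `|T(f·1_{B*∖A*})(x)| / ⟨f⟩_{B*,r}`. -/
def ringConst (T : Lp ℝ r μ → X → ℝ) (A B : 𝓑.balls) : ℝ≥0∞ :=
  ⨆ (x ∈ (A : Set X)) (f : Lp ℝ r μ),
    ‖T (cutoff f ((𝓑.measurableSet_hull B).diff (𝓑.measurableSet_hull A))) x‖ₑ
      / avg f (𝓑.hull B : Set X)

/-- The connectivity constant of `T`: the infimum of the constants `L` such that every ball `A` with
`A* ≠ X` has a ball `B ⊋ A` with `ringConst T A B ≤ L`. -/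
def connConst (T : Lp ℝ r μ → X → ℝ) : ℝ≥0∞ :=
  sInf {L : ℝ≥0∞ | ∀ A : 𝓑.balls, (𝓑.hull A : Set X) ≠ univ →
    ∃ B : 𝓑.balls, (A : Set X) ⊂ B ∧ 𝓑.ringConst T A B ≤ L}

/-- `T` is a bounded oscillation operator with respect to `𝓑`. -/
structure IsBoundedOscillation (T : Lp ℝ r μ → X → ℝ) : Prop where
  subadditive : IsSubadditiveOp T
  localization : 𝓑.locConst T < ∞
  connectivity : 𝓑.connConst T < ∞

end BallBasis

/-- The collection of sets `𝓢` is `γ`-sparse. -/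
def IsSparse (μ : Measure X) (γ : ℝ≥0) (𝓢 : Set (Set X)) : Prop :=
  ∃ E : Set X → Set X,
    (∀ B ∈ 𝓢, MeasurableSet (E B) ∧ E B ⊆ B ∧ γ * μ B ≤ μ (E B)) ∧ 𝓢.PairwiseDisjoint E

/-- `A_{𝓢,r} f(x) = ∑_{A ∈ 𝓢} ⟨f⟩_{A,r} 1_A(x)`. -/
def sparseOp (𝓢 : Set (Set X)) (f : Lp ℝ r μ) (x : X) : ℝ≥0∞ :=
  ∑' A : 𝓢, (A : Set X).indicator (fun _ => avg f (A : Set X)) x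

end Operators

end

/-!
Sparse domination of a bounded oscillation operator `T`, by a single greedy selection of balls.

Write `A*` for the hull of a ball and `Θ` for the sum of the constants of `T`. To every ball `A` one
attaches a truncation `f 1_{V A}` with `V A ⊆ A***`, and the set `E A` of the points at which
`T (f 1_{V A})`, its maximal truncation `sup_{B ∋ y} |T (f 1_{V A} 1_{X \ B*}) y|`, or the maximal
function of `f 1_{V A}` is much larger than the average of `f` over `A***` (times `Θ` for the first
two). Weak type estimates (`BallBasis.exists_exceptional_set`), all of them consequences of Vitali's
covering argument `BallBasis.mul_measure_sUnion_le`, make `E A` much smaller than `A`. The root is a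
ball `R` that contains the given ball and half of the `L^r` mass of `f`; its truncation is `f`
itself, and its exceptional set `Z` may spread over all of `X`.

The points of `Z` are declared active. Repeatedly one picks a nearly largest ball `A` half filled by
active points, and the points of `A* \ E A` become inactive
(`BallBasis.exists_greedy_selection`). The points of `A` itself that become inactive at this step
form a disjoint family of large parts, so the selected balls are sparse, and so are their third
hulls; since half-filled balls exist for every set of positive measure
(`BallBasis.exists_half_dense`), almost every point becomes inactive.

It remains to estimate `T f` at a point `x` that becomes inactive at `A`, where by definition
`T (f 1_{V A})` is controlled. The connectivity property gives a ball `D` that strictly contains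
`A**`. It is larger than `A*`, hence no longer half filled by active points when `A` is selected. At
the first time when this happens, `D` has an inactive point `y`, and `y` became inactive at a ball
`P` (or was never active: then `P` is the root) that was selected while `D` was still half filled;
so `P` is not much smaller than `D`, and `D* ⊆ P** ⊆ V P`. As `y` is not exceptional for `P`, the
localization and connectivity properties bound `T (f 1_{V P}) x` by `|T (f 1_{V A}) x|` plus a
multiple of the average over `P***` (`BallBasis.enorm_cutoff_le_add`). Moreover `x ∈ P**` again, so
this can be iterated; `P` was selected before `A`, so the chain ends at the root.
-/

/-! ### Geometry and covering in a ball-basis -/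

namespace BallBasis

section Geometry

variable {X : Type*} [MeasurableSpace X] {μ : Measure X} {K : ℝ≥0} (𝓑 : BallBasis μ K)

theorem measure_coe_pos (B : 𝓑.balls) : 0 < μ (B : Set X) := 𝓑.measure_pos _ B.2

theorem measure_coe_ne_top (B : 𝓑.balls) : μ (B : Set X) ≠ ∞ := (𝓑.measure_lt_top _ B.2).ne

theorem measurableSet_coe (B : 𝓑.balls) : MeasurableSet (B : Set X) := 𝓑.measurableSet _ B.2

theorem coe_nonempty (B : 𝓑.balls) : (B : Set X).Nonempty :=
  nonempty_of_measure_ne_zero (𝓑.measure_coe_pos B).ne'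

theorem subset_hull_of_inter {A B : 𝓑.balls} (h : μ (A : Set X) ≤ 2 * μ (B : Set X))
    (hAB : ((A : Set X) ∩ B).Nonempty) : (A : Set X) ⊆ 𝓑.hull B :=
  fun _ hx => 𝓑.subset_hull B ⟨A, ⟨A.2, h, hAB⟩, hx⟩

theorem self_subset_hull (B : 𝓑.balls) : (B : Set X) ⊆ 𝓑.hull B :=
  𝓑.subset_hull_of_inter (le_mul_of_one_le_left' one_le_two)
    (by simpa using 𝓑.coe_nonempty B)

theorem measure_le_measure_hull (B : 𝓑.balls) : μ (B : Set X) ≤ μ (𝓑.hull B : Set X) :=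
  measure_mono (𝓑.self_subset_hull B)

/-- Vitali's covering argument: the union of the balls in which the density of a finite measure
`ν` with respect to `μ` is at least `t` has measure at most `K ν(X) / t`. The union may be
uncountable, so its measure is an outer measure. -/
theorem mul_measure_sUnion_le (ν : Measure X) [IsFiniteMeasure ν] {t : ℝ≥0∞} (ht : t ≠ 0)
    (ht' : t ≠ ∞) (𝒢 : Set (Set X)) (h𝒢 : 𝒢 ⊆ 𝓑.balls) (h : ∀ A ∈ 𝒢, t * μ A ≤ ν A) :
    t * μ (⋃₀ 𝒢) ≤ K * ν univ := by
  have hle : ∀ A ∈ 𝒢, μ A ≤ ν univ / t := fun A hA => by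
    rw [ENNReal.le_div_iff_mul_le (.inl ht) (.inl ht'), mul_comm]
    exact (h A hA).trans (measure_mono (subset_univ _))
  have hfin : ν univ / t ≠ ∞ := ENNReal.div_ne_top (measure_ne_top _ _) ht
  obtain ⟨u, hu𝒢, hdisj, hcov⟩ := Vitali.exists_disjoint_subfamily_covering_enlargement
    (fun A : Set X => A) 𝒢 (fun A => (μ A).toReal) 2 one_lt_two (fun _ _ => ENNReal.toReal_nonneg)
    (ν univ / t).toReal (fun A hA => ENNReal.toReal_mono hfin (hle A hA))
    (fun A hA => nonempty_of_measure_ne_zero (𝓑.measure_pos A (h𝒢 hA)).ne')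
  have hcount : u.Countable := by
    have h1 : {A : u | 0 < ν (A : Set X)}.Countable :=
      Measure.countable_meas_pos_of_disjoint_iUnion
        (fun A : u => 𝓑.measurableSet _ (h𝒢 (hu𝒢 A.2)))
        (fun A B hAB => hdisj A.2 B.2 (fun h => hAB (Subtype.ext h)))
    have h2 : {A : u | 0 < ν (A : Set X)} = univ := by
      refine eq_univ_of_forall fun A => ?_
      exact lt_of_lt_of_le (ENNReal.mul_pos ht (𝓑.measure_pos _ (h𝒢 (hu𝒢 A.2))).ne')
        (h A (hu𝒢 A.2))
    rw [h2] at h1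
    exact countable_coe_iff.1 (countable_univ_iff.1 h1)
  have hsub : ⋃₀ 𝒢 ⊆ ⋃ A : u, (𝓑.hull ⟨A, h𝒢 (hu𝒢 A.2)⟩ : Set X) := by
    refine sUnion_subset fun A hA => ?_
    obtain ⟨B, hB, hne, hAB⟩ := hcov A hA
    refine subset_trans ?_ (subset_iUnion _ (⟨B, hB⟩ : u))
    refine 𝓑.subset_hull_of_inter (A := ⟨A, h𝒢 hA⟩) (B := ⟨B, h𝒢 (hu𝒢 hB)⟩) ?_ hne
    have hA' := 𝓑.measure_coe_ne_top ⟨A, h𝒢 hA⟩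
    have hB' := 𝓑.measure_coe_ne_top ⟨B, h𝒢 (hu𝒢 hB)⟩
    rw [← ENNReal.toReal_le_toReal hA' (ENNReal.mul_ne_top (by simp) hB')]
    simpa using hAB
  have := hcount.to_subtype
  calc t * μ (⋃₀ 𝒢) ≤ t * ∑' A : u, K * μ (A : Set X) := by
        gcongr
        exact (measure_mono hsub).trans ((measure_iUnion_le _).trans
          (ENNReal.tsum_le_tsum fun A => 𝓑.measure_hull_le _))
    _ = K * ∑' A : u, t * μ (A : Set X) := by
        rw [ENNReal.tsum_mul_left, ENNReal.tsum_mul_left]; ring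
    _ ≤ K * ∑' A : u, ν (A : Set X) := by
        gcongr with A
        exact h A (hu𝒢 A.2)
    _ ≤ K * ν univ := by
        gcongr
        exact tsum_measure_le_measure_univ
          (fun A => (𝓑.measurableSet _ (h𝒢 (hu𝒢 A.2))).nullMeasurableSet)
          (fun A B hAB => (hdisj A.2 B.2 (fun h => hAB (Subtype.ext h))).aedisjoint)

/-- A set of positive finite measure fills at least half of some ball. This is the only
consequence of the approximation axiom of a ball-basis that is needed. -/
theorem exists_half_dense {E : Set X} (hE : MeasurableSet E) (h0 : μ E ≠ 0) (hfin : μ E ≠ ∞) :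
    ∃ A : 𝓑.balls, μ (A : Set X) ≤ 2 * μ ((A : Set X) ∩ E) := by
  by_contra! hcon
  set ε : ℝ≥0∞ := μ E / (2 * K + 2) with hε
  have hε0 : 0 < ε := ENNReal.div_pos h0 (by finiteness)
  have hεfin : ε ≠ ∞ := ENNReal.div_ne_top hfin (by simp)
  obtain ⟨G, hG, hGc, hlt⟩ := 𝓑.exists_approx E hE ε hε0
  have hGm : MeasurableSet (⋃₀ G) := MeasurableSet.sUnion hGc fun A hA => 𝓑.measurableSet A (hG hA)
  have h1 : μ (E \ ⋃₀ G) ≤ ε := (measure_mono subset_union_left).trans hlt.le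
  have h2 : μ (⋃₀ G \ E) ≤ ε := (measure_mono subset_union_right).trans hlt.le
  have : IsFiniteMeasure (μ.restrict (⋃₀ G \ E)) :=
    ⟨by rw [Measure.restrict_apply_univ]; exact h2.trans_lt hεfin.lt_top⟩
  have h3 := 𝓑.mul_measure_sUnion_le (μ.restrict (⋃₀ G \ E)) (t := 2⁻¹) (by simp) (by simp) G hG
    (fun A hA => by
      have hA' := hcon ⟨A, hG hA⟩
      have hAfin := 𝓑.measure_coe_ne_top ⟨A, hG hA⟩
      simp only at hA' hAfin
      rw [Measure.restrict_apply (𝓑.measurableSet A (hG hA))]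
      have h4 : A ∩ (⋃₀ G \ E) = A \ E := by
        rw [← inter_sdiff_assoc, inter_eq_left.2 (subset_sUnion_of_mem hA)]
      rw [h4, mul_comm, ← div_eq_mul_inv]
      refine ENNReal.div_le_of_le_mul' ?_
      have h5 := measure_inter_add_sdiff (μ := μ) A hE
      have h6 : μ (A ∩ E) ≠ ∞ := measure_ne_top_of_subset inter_subset_left hAfin
      have h7 : μ (A ∩ E) ≤ μ (A \ E) := by
        by_contra! h8
        rw [two_mul] at hA'
        have := ENNReal.add_lt_add_left h6 h8
        rw [h5] at this
        exact lt_asymm this hA'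
      rw [two_mul]
      nth_rewrite 1 [← h5]
      gcongr)
  rw [Measure.restrict_apply_univ] at h3
  have h9 : μ (⋃₀ G) ≤ 2 * K * ε := by
    calc μ (⋃₀ G) = 2 * (2⁻¹ * μ (⋃₀ G)) := by
          rw [← mul_assoc, ENNReal.mul_inv_cancel (by simp) (by simp), one_mul]
      _ ≤ 2 * (K * ε) := mul_le_mul_right (h3.trans (mul_le_mul_right h2 _)) _
      _ = 2 * K * ε := by ring
  have h10 : μ E ≤ (2 * K + 1) * ε := by
    calc μ E ≤ μ (⋃₀ G) + μ (E \ ⋃₀ G) :=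
          (measure_mono (by rw [union_sdiff_self]; exact subset_union_right)).trans
            (measure_union_le _ _)
      _ ≤ 2 * K * ε + ε := by gcongr
      _ = (2 * K + 1) * ε := by ring
  have h11 : μ E = (2 * K + 2) * ε := by
    rw [hε, ENNReal.mul_div_cancel (by simp) (by finiteness)]
  rw [h11] at h10
  have h12 : ((2 * K + 1 : ℝ≥0∞)) * ε < (2 * K + 2) * ε := by
    refine ENNReal.mul_lt_mul_left hε0.ne' hεfin ?_
    have : (2 * K + 1 : ℝ≥0) < 2 * K + 2 := by
      have : (1 : ℝ≥0) < 2 := one_lt_two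
      gcongr
    exact_mod_cast this
  exact absurd h10 (not_le.2 h12)

/-- The space is exhausted by balls around any given ball: a finite measure has at least half of its
mass in some ball that contains the given one. -/
theorem exists_ball_half_mass (ν : Measure X) [IsFiniteMeasure ν] (B : 𝓑.balls) :
    ∃ R : 𝓑.balls, (B : Set X) ⊆ R ∧ ν univ ≤ 2 * ν (R : Set X) := by
  rcases eq_or_ne (ν univ) 0 with hν | hν
  · exact ⟨B, Subset.rfl, by simp [hν]⟩
  obtain ⟨x₀, hx₀⟩ := 𝓑.coe_nonempty B
  set S : Set ℝ≥0∞ := (fun A : 𝓑.balls => μ (A : Set X)) '' {A | x₀ ∈ (A : Set X)} with hS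
  obtain ⟨u, -, hu, huS⟩ := exists_seq_tendsto_sSup (S := S) ⟨_, B, hx₀, rfl⟩ (OrderTop.bddAbove S)
  choose A hA huA using huS
  -- balls through `x₀` whose measures tend to the supremum have hulls that eventually contain any
  -- ball through `x₀`
  have hev : ∀ A' : 𝓑.balls, x₀ ∈ (A' : Set X) →
      ∀ᶠ n in Filter.atTop, (A' : Set X) ⊆ 𝓑.hull (A n) := by
    intro A' hA'
    have h1 : μ (A' : Set X) / 2 < sSup S :=
      (ENNReal.half_lt_self (𝓑.measure_coe_pos A').ne' (𝓑.measure_coe_ne_top A')).trans_le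
        (le_sSup ⟨A', hA', rfl⟩)
    filter_upwards [hu.eventually (lt_mem_nhds h1)] with n hn
    refine 𝓑.subset_hull_of_inter ?_ ⟨x₀, hA', hA n⟩
    rw [← huA n] at hn
    rw [mul_comm]
    exact (ENNReal.div_le_iff_le_mul (.inl (by simp)) (.inl (by simp))).1 hn.le
  set s : ℕ → Set X := fun m => ⋂ n ≥ m, (𝓑.hull (A n) : Set X) with hs
  have hmono : Monotone s := fun m m' hm =>
    biInter_mono (fun n hn => le_trans hm hn) fun _ _ => le_rfl
  have hun : ⋃ m, s m = univ := by
    refine eq_univ_of_forall fun y => ?_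
    obtain ⟨A', hA'b, hx, hy⟩ := 𝓑.exists_mem_mem x₀ y
    obtain ⟨m, hm⟩ := Filter.eventually_atTop.1 (hev ⟨A', hA'b⟩ hx)
    exact mem_iUnion.2 ⟨m, mem_iInter₂.2 fun n hn => hm n hn hy⟩
  have ht := tendsto_measure_iUnion_atTop (μ := ν) hmono
  rw [hun] at ht
  have h2 := ht.eventually (lt_mem_nhds (ENNReal.half_lt_self hν (measure_ne_top _ _)))
  obtain ⟨m, hm1, hm2⟩ := (h2.and (hev B hx₀)).exists
  refine ⟨𝓑.hull (A m), hm2, ?_⟩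
  rw [mul_comm]
  refine (ENNReal.div_le_iff_le_mul (.inl (by simp)) (.inl (by simp))).1 (hm1.le.trans ?_)
  exact measure_mono (iInter₂_subset m le_rfl)

end Geometry

end BallBasis

/-! ### The greedy selection of balls -/

namespace BallBasis

section Greedy

variable {X : Type*} [MeasurableSpace X] {μ : Measure X} {K : ℝ≥0} (𝓑 : BallBasis μ K)

/-- The set `Z` fills at least half of the ball `A`. -/
def HalfDense (Z : Set X) (A : 𝓑.balls) : Prop :=
  μ (A : Set X) ≤ 2 * μ ((A : Set X) ∩ Z)

variable {𝓑}

theorem HalfDense.mono {Z Z' : Set X} {A : 𝓑.balls} (h : 𝓑.HalfDense Z A) (hZ : Z ⊆ Z') :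
    𝓑.HalfDense Z' A :=
  le_trans h (by gcongr)

theorem HalfDense.measure_le {Z : Set X} {A : 𝓑.balls} (h : 𝓑.HalfDense Z A) :
    μ (A : Set X) ≤ 2 * μ Z :=
  le_trans h (by gcongr; exact inter_subset_right)

theorem exists_notMem_of_not_halfDense {Z : Set X} {B : 𝓑.balls} (h : ¬ 𝓑.HalfDense Z B) :
    ∃ y ∈ (B : Set X), y ∉ Z := by
  by_contra! hcon
  refine h ?_
  rw [HalfDense, inter_eq_left.2 hcon]
  exact le_mul_of_one_le_left' one_le_two

variable (𝓑)

/-- `A` is a half-dense ball for `Z` whose hull is, up to a factor of two, the largest possible. -/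
def IsNearMax (Z : Set X) (A : 𝓑.balls) : Prop :=
  𝓑.HalfDense Z A ∧ ∀ A' : 𝓑.balls, 𝓑.HalfDense Z A' →
    μ (𝓑.hull A' : Set X) ≤ 2 * μ (𝓑.hull A : Set X)

theorem exists_isNearMax {Z : Set X} (hZ : μ Z ≠ ∞) (h : ∃ A, 𝓑.HalfDense Z A) :
    ∃ A, 𝓑.IsNearMax Z A := by
  obtain ⟨A₀, hA₀⟩ := h
  set s : ℝ≥0∞ := ⨆ (A : 𝓑.balls) (_ : 𝓑.HalfDense Z A), μ (𝓑.hull A : Set X) with hs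
  have hle : ∀ A, 𝓑.HalfDense Z A → μ (𝓑.hull A : Set X) ≤ s := fun A hA =>
    le_iSup₂ (f := fun (A : 𝓑.balls) (_ : 𝓑.HalfDense Z A) => μ (𝓑.hull A : Set X)) A hA
  have hfin : s ≠ ∞ := by
    refine ne_top_of_le_ne_top (b := K * (2 * μ Z)) (by finiteness) (iSup₂_le fun A hA => ?_)
    exact (𝓑.measure_hull_le A).trans (by gcongr; exact hA.measure_le)
  have hpos : s ≠ 0 := ((𝓑.measure_coe_pos _).trans_le (hle A₀ hA₀)).ne'
  obtain ⟨A, hA, hlt⟩ : ∃ A, ∃ _ : 𝓑.HalfDense Z A, s / 2 < μ (𝓑.hull A : Set X) := by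
    simpa only [hs, lt_iSup_iff] using ENNReal.half_lt_self hpos hfin
  refine ⟨A, hA, fun A' hA' => (hle A' hA').trans ?_⟩
  rw [mul_comm]
  exact (ENNReal.div_le_iff_le_mul (.inl (by simp)) (.inl (by simp))).1 hlt.le

/-- The greedy selection. Every ball `A` carries a small exceptional set `E A`. The points of `Z` are
active; one selects again and again a nearly largest ball `A` that is half filled by the active
points, and the points of `hull A` outside of `E A` cease to be active. Then

* the selected balls have large disjoint parts (the points of `A` that become inactive when `A` is
  selected);
* a ball `B` larger than a selected ball `A j` is no longer half filled by active points at the time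
  `j`, so it has a point that was never active or became inactive when some ball `A i` with `i < j`
  was selected; and at that time `B` was still half filled, so that `A i` is not much smaller than
  `B`;
* almost every point of `Z` becomes inactive.

The set `J` of times is `ℕ` or a finite initial segment. -/
theorem exists_greedy_selection (E : 𝓑.balls → Set X) (hE : ∀ A, MeasurableSet (E A))
    (hEμ : ∀ A : 𝓑.balls, 4 * μ (E A) ≤ μ (A : Set X)) {Z : Set X} (hZ : MeasurableSet Z)
    (hZfin : μ Z ≠ ∞) :
    ∃ (J : Set ℕ) (A : J → 𝓑.balls) (F : J → Set X),
      (∀ j, MeasurableSet (F j) ∧ F j ⊆ A j ∧ μ (A j : Set X) ≤ 4 * μ (F j)) ∧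
      Pairwise (Function.onFun Disjoint F) ∧
      (∀ j, μ (A j : Set X) ≤ 2 * μ Z) ∧
      (∀ j, ∀ B : 𝓑.balls, 2 * μ (𝓑.hull (A j) : Set X) < μ (𝓑.hull B : Set X) →
        ∃ y ∈ (B : Set X), y ∉ Z ∨ ∃ i < j, y ∈ (𝓑.hull (A i) : Set X) \ E (A i) ∧
          μ (𝓑.hull B : Set X) ≤ 2 * μ (𝓑.hull (A i) : Set X)) ∧
      ∀ᵐ x ∂μ, x ∈ Z → ∃ j, x ∈ (𝓑.hull (A j) : Set X) \ E (A j) := by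
  have hpick : ∀ Z : Set X, ∃ o : Option 𝓑.balls, μ Z ≠ ∞ →
      (o = none → ∀ A, ¬ 𝓑.HalfDense Z A) ∧ ∀ A, o = some A → 𝓑.IsNearMax Z A := by
    intro Z
    by_cases h : μ Z ≠ ∞ ∧ ∃ A, 𝓑.HalfDense Z A
    · obtain ⟨A, hA⟩ := 𝓑.exists_isNearMax h.1 h.2
      refine ⟨some A, fun _ => ⟨by simp, fun A' hA' => ?_⟩⟩
      rwa [← Option.some_injective _ hA']
    · push Not at h
      exact ⟨none, fun hfin => ⟨fun _ => h hfin, by simp⟩⟩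
  choose pick hpick using hpick
  set next : Set X → Set X := fun Z => Z \ ⋃ A ∈ pick Z, (𝓑.hull A : Set X) \ E A with hnext
  have hnext_some : ∀ {Z A}, pick Z = some A → next Z = Z \ ((𝓑.hull A : Set X) \ E A) := by
    intro Z A h
    simp only [hnext, h, Option.mem_def, Option.some.injEq, iUnion_iUnion_eq_right]
  set act : ℕ → Set X := fun n => next^[n] Z with hact
  have hact_succ : ∀ n, act (n + 1) = next (act n) := fun n => Function.iterate_succ_apply' _ _ _
  have hanti : Antitone act := antitone_nat_of_succ_le fun n => by
    rw [hact_succ]; exact sdiff_subset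
  have hact_sub : ∀ n, act n ⊆ Z := fun n => hanti (Nat.zero_le n)
  have hact_fin : ∀ n, μ (act n) ≠ ∞ := fun n => measure_ne_top_of_subset (hact_sub n) hZfin
  have hact_meas : ∀ n, MeasurableSet (act n) := by
    intro n
    induction n with
    | zero => exact hZ
    | succ n ih =>
      rw [hact_succ]
      rcases h : pick (act n) with _ | A
      · simpa [hnext, h] using ih
      · rw [hnext_some h]
        exact ih.diff ((𝓑.measurableSet_hull A).diff (hE A))
  set J : Set ℕ := {n | (pick (act n)).isSome} with hJ
  set A : J → 𝓑.balls := fun j => (pick (act j)).get j.2 with hA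
  have hpA : ∀ j : J, pick (act j) = some (A j) := fun j => (Option.some_get _).symm
  have hmax : ∀ j : J, 𝓑.IsNearMax (act j) (A j) := fun j => (hpick _ (hact_fin j)).2 _ (hpA j)
  have hsucc : ∀ j : J, act (j + 1) = act j \ ((𝓑.hull (A j) : Set X) \ E (A j)) := fun j => by
    rw [hact_succ, hnext_some (hpA j)]
  -- a point that ceases to be active does so at a definite time
  have hleave : ∀ (n : ℕ) (y : X), y ∈ Z → y ∉ act n →
      ∃ i : J, (i : ℕ) < n ∧ y ∈ (𝓑.hull (A i) : Set X) \ E (A i) := by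
    intro n y hyZ hy
    induction n with
    | zero => exact absurd hyZ hy
    | succ n ih =>
      by_cases hyn : y ∈ act n
      · have hn : n ∈ J := by
          by_contra hn
          have : pick (act n) = none := by simpa [hJ] using hn
          refine hy ?_
          rw [hact_succ]
          simpa [hnext, this] using hyn
        refine ⟨⟨n, hn⟩, Nat.lt_succ_self n, ?_⟩
        by_contra hcon
        exact hy (by rw [hsucc ⟨n, hn⟩]; exact ⟨hyn, hcon⟩)
      · obtain ⟨i, hi, h⟩ := ih hyn
        exact ⟨i, hi.trans (Nat.lt_succ_self n), h⟩
  set F : J → Set X := fun j => ((A j : Set X) ∩ act j) \ E (A j) with hF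
  have hFm : ∀ j, MeasurableSet (F j) := fun j =>
    ((𝓑.measurableSet_coe _).inter (hact_meas _)).diff (hE _)
  have hFA : ∀ j, F j ⊆ A j := fun j => sdiff_subset.trans inter_subset_left
  have hFμ : ∀ j, μ (A j : Set X) ≤ 4 * μ (F j) := by
    intro j
    have h1 : 2 * μ (A j : Set X) ≤ 4 * μ ((A j : Set X) ∩ act j) := by
      calc 2 * μ (A j : Set X) ≤ 2 * (2 * μ ((A j : Set X) ∩ act j)) := by
            gcongr; exact (hmax j).1
        _ = 4 * μ ((A j : Set X) ∩ act j) := by rw [← mul_assoc]; norm_num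
    have h2 : μ ((A j : Set X) ∩ act j) ≤ μ (F j) + μ (E (A j)) := by
      refine (measure_mono (t := F j ∪ E (A j)) ?_).trans (measure_union_le _ _)
      rw [hF, sdiff_union_self]
      exact subset_union_left
    have h3 : μ (A j : Set X) + μ (A j : Set X) ≤ 4 * μ (F j) + μ (A j : Set X) := by
      calc μ (A j : Set X) + μ (A j : Set X) = 2 * μ (A j : Set X) := (two_mul _).symm
        _ ≤ 4 * (μ (F j) + μ (E (A j))) := h1.trans (by gcongr)
        _ = 4 * μ (F j) + 4 * μ (E (A j)) := mul_add _ _ _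
        _ ≤ 4 * μ (F j) + μ (A j : Set X) := by gcongr; exact hEμ _
    exact (ENNReal.add_le_add_iff_right (𝓑.measure_coe_ne_top _)).1 h3
  have hFdisj : Pairwise (Function.onFun Disjoint F) := by
    refine (pairwise_disjoint_on F).2 fun i j hij => disjoint_left.2 fun x hxi hxj => ?_
    have h1 : x ∈ act (i + 1) := hanti (Nat.succ_le_of_lt hij) hxj.1.2
    rw [hsucc] at h1
    exact h1.2 ⟨𝓑.self_subset_hull _ hxi.1.1, hxi.2⟩
  refine ⟨J, A, F, fun j => ⟨hFm j, hFA j, hFμ j⟩, hFdisj, fun j => ?_, fun j B hB => ?_, ?_⟩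
  · exact (hmax j).1.measure_le.trans (by gcongr; exact hact_sub _)
  · classical
    have hj : ¬ 𝓑.HalfDense (act j) B := fun h => absurd ((hmax j).2 B h) (not_le.2 hB)
    have hex : ∃ n, ¬ 𝓑.HalfDense (act n) B := ⟨j, hj⟩
    obtain ⟨y, hyB, hy⟩ := exists_notMem_of_not_halfDense (Nat.find_spec hex)
    refine ⟨y, hyB, or_iff_not_imp_left.2 fun hyZ => ?_⟩
    obtain ⟨i, hi, hyi⟩ := hleave _ y (not_not.1 hyZ) hy
    refine ⟨i, hi.trans_le (Nat.find_min' hex hj), hyi, (hmax i).2 B ?_⟩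
    exact not_not.1 (Nat.find_min hex hi)
  · have hnull : μ (⋂ n, act n) = 0 := by
      by_contra h0
      have hIm : MeasurableSet (⋂ n, act n) := MeasurableSet.iInter hact_meas
      have hIfin : μ (⋂ n, act n) ≠ ∞ := measure_ne_top_of_subset (iInter_subset _ 0) (hact_fin 0)
      obtain ⟨D, hD⟩ := 𝓑.exists_half_dense hIm h0 hIfin
      have hD' : ∀ n, 𝓑.HalfDense (act n) D := fun n =>
        HalfDense.mono (𝓑 := 𝓑) hD (iInter_subset _ n)
      have hJall : ∀ n, n ∈ J := by
        intro n
        by_contra hn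
        have : pick (act n) = none := by simpa [hJ] using hn
        exact (hpick _ (hact_fin n)).1 this D (hD' n)
      -- the disjoint sets `F j` have finite total measure, so the selected balls shrink to zero
      have hsum : ∑' n : ℕ, μ (F ⟨n, hJall n⟩) ≠ ∞ := by
        refine ne_top_of_le_ne_top hZfin ?_
        rw [← measure_iUnion (f := fun n => F ⟨n, hJall n⟩)
          (fun m n hmn => hFdisj (by simpa using hmn)) fun n => hFm _]
        exact measure_mono (iUnion_subset fun n =>
          (sdiff_subset.trans inter_subset_right).trans (hact_sub n))
      have hlim := ENNReal.Tendsto.const_mul (a := 2 * (K * 4))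
        (ENNReal.tendsto_atTop_zero_of_tsum_ne_top hsum) (Or.inr (by finiteness))
      rw [mul_zero] at hlim
      have hpos : 0 < μ (𝓑.hull D : Set X) := 𝓑.measure_coe_pos _
      obtain ⟨n, hn⟩ := (hlim.eventually (gt_mem_nhds hpos)).exists
      refine absurd hn (not_lt.2 ?_)
      calc μ (𝓑.hull D : Set X) ≤ 2 * μ (𝓑.hull (A ⟨n, hJall n⟩) : Set X) :=
            (hmax ⟨n, hJall n⟩).2 D (hD' n)
        _ ≤ 2 * (K * (4 * μ (F ⟨n, hJall n⟩))) := by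
            gcongr
            exact (𝓑.measure_hull_le _).trans (by gcongr; exact hFμ _)
        _ = 2 * (K * 4) * μ (F ⟨n, hJall n⟩) := by ring
    filter_upwards [measure_eq_zero_iff_ae_notMem.1 hnull] with x hx hxZ
    obtain ⟨n, hn⟩ : ∃ n, x ∉ act n := by simpa using hx
    obtain ⟨i, -, hi⟩ := hleave n x hxZ hn
    exact ⟨i, hi⟩

end Greedy

end BallBasis

/-! ### Energies, averages and cutoffs of `L^r` functions -/

section Energy

variable {X : Type*} [MeasurableSpace X] {μ : Measure X} {K r : ℝ≥0}

/-- The energy `∫_S |f|^r dμ` of `f ∈ L^r` on the set `S`. -/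
noncomputable def energy (f : Lp ℝ r μ) (S : Set X) : ℝ≥0∞ := ∫⁻ x in S, ‖f x‖ₑ ^ (r : ℝ) ∂μ

theorem energy_mono (f : Lp ℝ r μ) {S S' : Set X} (h : S ⊆ S') : energy f S ≤ energy f S' :=
  lintegral_mono_set h

theorem one_le_coe (hr : 1 ≤ r) : (1 : ℝ) ≤ r := by exact_mod_cast hr

theorem coe_pos (hr : 1 ≤ r) : (0 : ℝ) < r := zero_lt_one.trans_le (one_le_coe hr)

theorem rpow_one_div_rpow (hr : 1 ≤ r) (a : ℝ≥0∞) : (a ^ (1 / (r : ℝ))) ^ (r : ℝ) = a := by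
  rw [← ENNReal.rpow_mul, one_div_mul_cancel (coe_pos hr).ne', ENNReal.rpow_one]

theorem eLpNorm_rpow_eq_energy (hr : 1 ≤ r) (f : Lp ℝ r μ) :
    eLpNorm f r μ ^ (r : ℝ) = energy f univ := by
  have h0 : (r : ℝ≥0∞) ≠ 0 := by
    simpa using (zero_lt_one.trans_le hr).ne'
  rw [eLpNorm_eq_lintegral_rpow_enorm_toReal h0 ENNReal.coe_ne_top, ENNReal.coe_toReal,
    rpow_one_div_rpow hr, energy, Measure.restrict_univ]

theorem energy_ne_top (hr : 1 ≤ r) (f : Lp ℝ r μ) (S : Set X) : energy f S ≠ ∞ := by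
  refine ne_top_of_le_ne_top ?_ (energy_mono f (subset_univ S))
  rw [← eLpNorm_rpow_eq_energy hr]
  exact ENNReal.rpow_ne_top_of_nonneg (coe_pos hr).le (Lp.eLpNorm_ne_top f)

theorem avg_eq_energy (f : Lp ℝ r μ) (B : Set X) :
    avg f B = ((μ B)⁻¹ * energy f B) ^ (1 / (r : ℝ)) := rfl

theorem avg_le_iff (hr : 1 ≤ r) (f : Lp ℝ r μ) {B : Set X} (h0 : μ B ≠ 0) (hfin : μ B ≠ ∞)
    (s : ℝ≥0∞) : avg f B ≤ s ↔ energy f B ≤ s ^ (r : ℝ) * μ B := by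
  rw [← ENNReal.rpow_le_rpow_iff (coe_pos hr), avg_eq_energy, rpow_one_div_rpow hr, mul_comm,
    ← div_eq_mul_inv, ENNReal.div_le_iff h0 hfin]

theorem energy_eq_avg (hr : 1 ≤ r) (f : Lp ℝ r μ) {B : Set X} (h0 : μ B ≠ 0) (hfin : μ B ≠ ∞) :
    energy f B = avg f B ^ (r : ℝ) * μ B := by
  rw [avg_eq_energy, rpow_one_div_rpow hr, mul_comm, ← mul_assoc, ENNReal.mul_inv_cancel h0 hfin,
    one_mul]

theorem avg_ne_top (hr : 1 ≤ r) (f : Lp ℝ r μ) {B : Set X} (h0 : μ B ≠ 0) : avg f B ≠ ∞ := by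
  rw [avg_eq_energy]
  exact ENNReal.rpow_ne_top_of_nonneg (by positivity)
    (ENNReal.mul_ne_top (ENNReal.inv_ne_top.2 h0) (energy_ne_top hr f B))

theorem eq_zero_of_energy_univ (hr : 1 ≤ r) {f : Lp ℝ r μ} (h : energy f univ = 0) : f = 0 := by
  have h0 : (r : ℝ≥0∞) ≠ 0 := by
    simpa using (zero_lt_one.trans_le hr).ne'
  rw [← eLpNorm_rpow_eq_energy hr, ENNReal.rpow_eq_zero_iff_of_pos (coe_pos hr)] at h
  exact (Lp.eq_zero_iff_ae_eq_zero).2 ((eLpNorm_eq_zero_iff (Lp.aestronglyMeasurable f) h0).1 h)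

theorem coeFn_cutoff (f : Lp ℝ r μ) {E : Set X} (hE : MeasurableSet E) :
    cutoff f hE =ᵐ[μ] E.indicator f :=
  MemLp.coeFn_toLp _

theorem cutoff_congr (f : Lp ℝ r μ) {E F : Set X} (hE : MeasurableSet E) (hF : MeasurableSet F)
    (h : E = F) : cutoff f hE = cutoff f hF := by
  subst h; rfl

theorem cutoff_univ (f : Lp ℝ r μ) : cutoff f MeasurableSet.univ = f := by
  refine Lp.ext ((coeFn_cutoff f _).trans ?_)
  rw [indicator_univ]

theorem cutoff_cutoff (f : Lp ℝ r μ) {E F : Set X} (hE : MeasurableSet E) (hF : MeasurableSet F) :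
    cutoff (cutoff f hE) hF = cutoff f (hE.inter hF) := by
  refine Lp.ext ((coeFn_cutoff _ hF).trans (Filter.EventuallyEq.trans ?_ (coeFn_cutoff f _).symm))
  filter_upwards [coeFn_cutoff f hE] with x hx
  by_cases h : x ∈ F <;> by_cases h' : x ∈ E <;> simp [indicator, h, h', hx]

theorem cutoff_union (f : Lp ℝ r μ) {E F : Set X} (hE : MeasurableSet E) (hF : MeasurableSet F)
    (h : Disjoint E F) : cutoff f (hE.union hF) = cutoff f hE + cutoff f hF := by
  refine Lp.ext ((coeFn_cutoff f _).trans (Filter.EventuallyEq.trans ?_ (Lp.coeFn_add _ _).symm))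
  filter_upwards [coeFn_cutoff f hE, coeFn_cutoff f hF] with x hx hx'
  rw [indicator_union_of_disjoint h, Pi.add_apply, hx, hx']

theorem cutoff_add_cutoff_compl (f : Lp ℝ r μ) {E : Set X} (hE : MeasurableSet E) :
    cutoff f hE + cutoff f hE.compl = f := by
  rw [← cutoff_union f hE hE.compl disjoint_compl_right,
    cutoff_congr f _ MeasurableSet.univ (union_compl_self E), cutoff_univ]

theorem energy_cutoff (hr : 1 ≤ r) (f : Lp ℝ r μ) {E : Set X} (hE : MeasurableSet E) (S : Set X) :
    energy (cutoff f hE) S = energy f (E ∩ S) := by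
  have h : ∀ᵐ x ∂μ.restrict S,
      ‖cutoff f hE x‖ₑ ^ (r : ℝ) = E.indicator (fun x => ‖f x‖ₑ ^ (r : ℝ)) x := by
    filter_upwards [ae_restrict_of_ae (coeFn_cutoff f hE)] with x hx
    rw [hx]
    by_cases h : x ∈ E <;> simp [h, coe_pos hr]
  rw [energy, energy, lintegral_congr_ae h, lintegral_indicator hE, Measure.restrict_restrict hE]

theorem avg_cutoff_of_subset (hr : 1 ≤ r) (f : Lp ℝ r μ) {E : Set X} (hE : MeasurableSet E)
    {B : Set X} (h : B ⊆ E) : avg (cutoff f hE) B = avg f B := by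
  rw [avg_eq_energy, avg_eq_energy, energy_cutoff hr, inter_eq_right.2 h]

theorem isFiniteMeasure_withDensity_enorm_rpow (hr : 1 ≤ r) (f : Lp ℝ r μ) :
    IsFiniteMeasure (μ.withDensity fun x => ‖f x‖ₑ ^ (r : ℝ)) :=
  MeasureTheory.isFiniteMeasure_withDensity (by
    have := energy_ne_top hr f univ
    rwa [energy, Measure.restrict_univ] at this)

theorem withDensity_eq_energy (f : Lp ℝ r μ) {S : Set X} (hS : MeasurableSet S) :
    μ.withDensity (fun x => ‖f x‖ₑ ^ (r : ℝ)) S = energy f S :=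
  withDensity_apply _ hS

end Energy

/-! ### Subadditive operators of weak type and their exceptional sets -/

section Operator

variable {X : Type*} [MeasurableSpace X] {μ : Measure X} {K r : ℝ≥0} {T : Lp ℝ r μ → X → ℝ}

theorem IsSubadditiveOp.apply_zero (hT : IsSubadditiveOp T) (x : X) : T 0 x = 0 := by
  have := hT.abs_smul 0 0 x
  simpa using this

theorem IsSubadditiveOp.enorm_add_le (hT : IsSubadditiveOp T) (f g : Lp ℝ r μ) (x : X) :
    ‖T (f + g) x‖ₑ ≤ ‖T f x‖ₑ + ‖T g x‖ₑ := by
  have h := hT.abs_add_le f g x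
  rw [← ofReal_norm, ← ofReal_norm, ← ofReal_norm,
    ← ENNReal.ofReal_add (norm_nonneg _) (norm_nonneg _)]
  exact ENNReal.ofReal_le_ofReal h

theorem IsSubadditiveOp.enorm_neg (hT : IsSubadditiveOp T) (f : Lp ℝ r μ) (x : X) :
    ‖T (-f) x‖ₑ = ‖T f x‖ₑ := by
  have h := hT.abs_smul (-1) f x
  rw [neg_one_smul, abs_neg, abs_one, one_mul] at h
  rw [← ofReal_norm, ← ofReal_norm]
  exact congrArg _ h

theorem IsSubadditiveOp.enorm_le_add_of_add_eq (hT : IsSubadditiveOp T) {f g h : Lp ℝ r μ}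
    (hfg : f + g = h) (x : X) : ‖T g x‖ₑ ≤ ‖T h x‖ₑ + ‖T f x‖ₑ := by
  have : g = h + -f := by rw [← hfg]; abel
  rw [this, ← hT.enorm_neg f]
  exact hT.enorm_add_le _ _ _

/-- The weak type inequality in the form of Chebyshev's inequality. -/
theorem rpow_mul_measure_le {τ : ℝ≥0} (hr : 1 ≤ r) (hτ : weakNorm T ≤ τ) (f : Lp ℝ r μ)
    {s : ℝ≥0} (hs : 0 < s) :
    (s : ℝ≥0∞) ^ (r : ℝ) * μ {x | (s : ℝ≥0∞) < ‖T f x‖ₑ}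
      ≤ (τ : ℝ≥0∞) ^ (r : ℝ) * energy f univ := by
  have hset : {x | (s : ℝ≥0∞) < ‖T f x‖ₑ} = {x | (s : ℝ) < |T f x|} := by
    ext x
    rw [mem_ofPred_eq, mem_ofPred_eq, enorm_eq_nnnorm, ENNReal.coe_lt_coe, ← NNReal.coe_lt_coe,
      coe_nnnorm, Real.norm_eq_abs]
  have h1 : (s : ℝ≥0∞) * μ {x | (s : ℝ) < |T f x|} ^ (1 / (r : ℝ)) / eLpNorm f r μ ≤ τ :=
    le_trans (le_iSup_of_le s (le_iSup_of_le hs (le_iSup (fun f : Lp ℝ r μ => (s : ℝ≥0∞) *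
      μ {x | (s : ℝ) < |T f x|} ^ (1 / (r : ℝ)) / eLpNorm f r μ) f))) hτ
  rw [ENNReal.div_le_iff_le_mul (.inr ENNReal.coe_ne_top) (.inl (Lp.eLpNorm_ne_top f)), ← hset]
    at h1
  have h2 := ENNReal.rpow_le_rpow h1 (coe_pos hr).le
  rwa [ENNReal.mul_rpow_of_nonneg _ _ (coe_pos hr).le,
    ENNReal.mul_rpow_of_nonneg _ _ (coe_pos hr).le, rpow_one_div_rpow hr,
    eLpNorm_rpow_eq_energy hr] at h2

theorem BallBasis.enorm_sub_le_mul_avgStar (𝓑 : BallBasis μ K) {τ : ℝ≥0}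
    (hτ : 𝓑.locConst T ≤ τ) (f : Lp ℝ r μ) (B : 𝓑.balls) (hfin : 𝓑.avgStar f B ≠ ∞)
    {x y : X} (hx : x ∈ (B : Set X)) (hy : y ∈ (B : Set X)) :
    ‖T (cutoff f (𝓑.measurableSet_hull B).compl) x‖ₑ ≤
      ‖T (cutoff f (𝓑.measurableSet_hull B).compl) y‖ₑ + τ * 𝓑.avgStar f B := by
  set g := cutoff f (𝓑.measurableSet_hull B).compl with hg
  have h1 : ‖T g x - T g y‖ₑ / 𝓑.avgStar f B ≤ τ := by
    refine le_trans ?_ hτ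
    exact le_iSup_of_le B (le_iSup₂_of_le x hx (le_iSup₂_of_le y hy (le_iSup_of_le f le_rfl)))
  rw [ENNReal.div_le_iff_le_mul (.inr ENNReal.coe_ne_top) (.inl hfin)] at h1
  calc ‖T g x‖ₑ = ‖T g y + (T g x - T g y)‖ₑ := by rw [add_sub_cancel]
    _ ≤ ‖T g y‖ₑ + ‖T g x - T g y‖ₑ := enorm_add_le _ _
    _ ≤ _ := by gcongr

/-- The part of `f` in the ring `hull B \ hull A` is controlled on `A`. -/
theorem BallBasis.enorm_ring_le (𝓑 : BallBasis μ K) {A B : 𝓑.balls} {L : ℝ≥0} (hr : 1 ≤ r)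
    (hL : 𝓑.ringConst T A B ≤ L) (f : Lp ℝ r μ) {x : X} (hx : x ∈ (A : Set X)) :
    ‖T (cutoff f ((𝓑.measurableSet_hull B).diff (𝓑.measurableSet_hull A))) x‖ₑ
      ≤ L * avg f (𝓑.hull B : Set X) := by
  have h1 : ‖T (cutoff f ((𝓑.measurableSet_hull B).diff (𝓑.measurableSet_hull A))) x‖ₑ
      / avg f (𝓑.hull B : Set X) ≤ L :=
    le_trans (le_iSup₂_of_le x hx (le_iSup (fun f : Lp ℝ r μ =>
      ‖T (cutoff f ((𝓑.measurableSet_hull B).diff (𝓑.measurableSet_hull A))) x‖ₑ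
        / avg f (𝓑.hull B : Set X)) f)) hL
  rwa [ENNReal.div_le_iff_le_mul (.inr ENNReal.coe_ne_top)
    (.inl (avg_ne_top hr f (𝓑.measure_coe_pos _).ne'))] at h1

end Operator

section Exceptional

variable {X : Type*} [MeasurableSpace X] {μ : Measure X} {K r : ℝ≥0} {T : Lp ℝ r μ → X → ℝ}

theorem mul_le_of_rpow_mul_le (hr : 1 ≤ r) {N s p q : ℝ≥0∞} (hN : 1 ≤ N) (hs : s ≠ 0)
    (hs' : s ≠ ∞) (h : (N * s) ^ (r : ℝ) * p ≤ s ^ (r : ℝ) * q) : N * p ≤ q := by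
  rw [ENNReal.mul_rpow_of_nonneg _ _ (coe_pos hr).le, mul_comm (N ^ (r : ℝ)), mul_assoc,
    ENNReal.mul_le_mul_iff_right (by simp [hs, hs'])
      (ENNReal.rpow_ne_top_of_nonneg (coe_pos hr).le hs')] at h
  refine le_trans ?_ h
  gcongr
  exact ENNReal.le_rpow_self_of_one_le hN (one_le_coe hr)

/-- The level, relative to the average of a function, beyond which an operator or a maximal function
counts as exceptionally large. -/
def excLevel (K : ℝ≥0) : ℝ≥0 := 60 * (K + 1) ^ 5

/-- Outside of a small set `E`, the function `T g`, its maximal truncation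
`y ↦ sup_{B ∋ y} |T (g 1_{X \ B*}) y|`, and the maximal function of `g` are all controlled by the
level `l` at which the `L^r` norm of `g` is spread over mass `m`. This is the weak type estimate for
the maximal truncation: if it is large at a point of a ball `B`, then by the localization property
`T (g 1_{X \ B*})` is large on all of `B`; since `T (g 1_{B*})` is small on half of `B`, the set
where `T g` is large fills half of `B`, and the covering argument applies. -/
theorem BallBasis.exists_exceptional_set (𝓑 : BallBasis μ K) (hr : 1 ≤ r) (hT : IsSubadditiveOp T)
    {τ : ℝ≥0} (hτ : 0 < τ) (hloc : 𝓑.locConst T ≤ τ) (hweak : weakNorm T ≤ τ) (g : Lp ℝ r μ)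
    (l : ℝ≥0) {m : ℝ≥0∞} (hm : m ≠ ∞) (hg : energy g univ ≤ (l : ℝ≥0∞) ^ (r : ℝ) * m) :
    ∃ E : Set X, MeasurableSet E ∧ 4 * ((K : ℝ≥0∞) + 1) ^ 3 * μ E ≤ m ∧
      ∀ y ∉ E, ‖T g y‖ₑ ≤ excLevel K * τ * l ∧ ∀ B : 𝓑.balls, y ∈ (B : Set X) →
        ‖T (cutoff g (𝓑.measurableSet_hull B).compl) y‖ₑ ≤ excLevel K * τ * l ∧
          avg g (B : Set X) ≤ excLevel K * l := by
  rcases eq_or_ne l 0 with rfl | hl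
  · have h0 : energy g univ = 0 := by
      simpa [coe_pos hr] using hg
    have hcut : ∀ {S : Set X} (hS : MeasurableSet S), cutoff g hS = 0 := fun hS =>
      eq_zero_of_energy_univ hr (by
        rw [energy_cutoff hr]
        exact le_antisymm ((energy_mono g (subset_univ _)).trans h0.le) zero_le)
    refine ⟨∅, MeasurableSet.empty, by simp, fun y _ => ⟨?_, fun B _ => ⟨?_, ?_⟩⟩⟩
    · rw [eq_zero_of_energy_univ hr h0, hT.apply_zero]; simp
    · rw [hcut, hT.apply_zero]; simp
    · rw [avg_le_iff hr g (𝓑.measure_coe_pos B).ne' (𝓑.measure_coe_ne_top B)]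
      exact ((energy_mono g (subset_univ _)).trans h0.le).trans zero_le
  have hl0 : (l : ℝ≥0∞) ≠ 0 := by exact_mod_cast hl
  have hτ0 : (τ : ℝ≥0∞) ≠ 0 := by exact_mod_cast hτ.ne'
  set k : ℝ≥0 := K + 1 with hk
  have hk1 : 1 ≤ k := le_add_of_nonneg_left zero_le
  have hKk : (K : ℝ≥0∞) ≤ k := by exact_mod_cast le_add_of_nonneg_right zero_le
  -- three exceptional sets, each of measure at most `k m / N`: `3 k / N` is `1 / (4 k ^ 3)`
  set N : ℝ≥0 := 12 * k ^ 4 with hN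
  have hN1 : 1 ≤ N := by
    calc (1 : ℝ≥0) ≤ 12 * 1 ^ 4 := by norm_num
      _ ≤ N := by rw [hN]; gcongr
  have hN1' : (1 : ℝ≥0∞) ≤ N := by exact_mod_cast hN1
  have hN0 : 0 < N := zero_lt_one.trans_le hN1
  -- the level for the maximal truncation has to exceed the sum of `2 N` for `T g`, `2 k N` for the
  -- local part and `N` for the oscillation
  have hexc : excLevel K = 5 * k * N := by rw [excLevel, hN]; ring
  -- points with a large maximal function
  set 𝒢 : Set (Set X) := {A | A ∈ 𝓑.balls ∧ (N : ℝ≥0∞) * l < avg g A} with h𝒢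
  have hE1 : N * μ (⋃₀ 𝒢) ≤ K * m := by
    have := isFiniteMeasure_withDensity_enorm_rpow hr g
    have hNl : (N : ℝ≥0∞) * l ≠ 0 := mul_ne_zero (by exact_mod_cast hN0.ne') hl0
    refine mul_le_of_rpow_mul_le hr hN1' hl0 ENNReal.coe_ne_top
      ((𝓑.mul_measure_sUnion_le (μ.withDensity fun x => ‖g x‖ₑ ^ (r : ℝ)) ?_ ?_ 𝒢
        (fun A hA => hA.1) fun A hA => ?_).trans ?_)
    · simp [hNl, ENNReal.mul_eq_top]
    · exact ENNReal.rpow_ne_top_of_nonneg (coe_pos hr).le (by finiteness)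
    · rw [withDensity_eq_energy g (𝓑.measurableSet A hA.1),
        energy_eq_avg hr g (𝓑.measure_pos A hA.1).ne' (𝓑.measure_lt_top A hA.1).ne]
      gcongr
      exact hA.2.le
    · rw [withDensity_eq_energy g MeasurableSet.univ]
      calc K * energy g univ ≤ K * ((l : ℝ≥0∞) ^ (r : ℝ) * m) := by gcongr
        _ = (l : ℝ≥0∞) ^ (r : ℝ) * (K * m) := by ring
  -- points where `T g` is large
  set H : Set X := toMeasurable μ {x | ((2 * N * (τ * l) : ℝ≥0) : ℝ≥0∞) < ‖T g x‖ₑ} with hH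
  have hE2 : 2 * N * μ H ≤ m := by
    rw [hH, measure_toMeasurable]
    have h := rpow_mul_measure_le hr hweak g (s := 2 * N * (τ * l))
      (mul_pos (mul_pos two_pos hN0) (mul_pos hτ (pos_iff_ne_zero.2 hl)))
    refine mul_le_of_rpow_mul_le (s := τ * l) hr (one_le_mul one_le_two hN1')
      (mul_ne_zero hτ0 hl0) (by finiteness) ?_
    push_cast at h ⊢
    refine h.trans ?_
    rw [ENNReal.mul_rpow_of_nonneg _ _ (coe_pos hr).le, mul_assoc]
    gcongr
  have hHfin : μ H < ∞ := by
    refine lt_of_le_of_lt (le_trans ?_ hE2) hm.lt_top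
    exact le_mul_of_one_le_left' (one_le_mul one_le_two hN1')
  -- points of balls half filled by the points where `T g` is large
  set 𝒟 : Set (Set X) := {A | A ∈ 𝓑.balls ∧ μ A ≤ 2 * μ (A ∩ H)} with h𝒟
  have hE3 : N * μ (⋃₀ 𝒟) ≤ K * m := by
    have : IsFiniteMeasure (μ.restrict H) := ⟨by rwa [Measure.restrict_apply_univ]⟩
    have h := 𝓑.mul_measure_sUnion_le (μ.restrict H) (t := 2⁻¹) (by simp) (by simp) 𝒟
      (fun A hA => hA.1) fun A hA => by
        rw [Measure.restrict_apply (𝓑.measurableSet A hA.1), mul_comm, ← div_eq_mul_inv]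
        exact ENNReal.div_le_of_le_mul' hA.2
    rw [Measure.restrict_apply_univ] at h
    calc (N : ℝ≥0∞) * μ (⋃₀ 𝒟) = 2 * N * (2⁻¹ * μ (⋃₀ 𝒟)) := by
          have : (2 : ℝ≥0∞) * 2⁻¹ = 1 := ENNReal.mul_inv_cancel (by simp) (by simp)
          calc (N : ℝ≥0∞) * μ (⋃₀ 𝒟) = N * (2 * 2⁻¹) * μ (⋃₀ 𝒟) := by rw [this, mul_one]
            _ = _ := by ring
      _ ≤ 2 * N * (K * μ H) := mul_le_mul_right h _
      _ = K * (2 * N * μ H) := by ring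
      _ ≤ K * m := mul_le_mul_right hE2 _
  refine ⟨toMeasurable μ (⋃₀ 𝒢 ∪ H ∪ ⋃₀ 𝒟), measurableSet_toMeasurable _ _, ?_, ?_⟩
  · rw [measure_toMeasurable]
    have h1 : N * μ (⋃₀ 𝒢 ∪ H ∪ ⋃₀ 𝒟) ≤ (3 * k : ℝ≥0) * m := by
      have h2 : N * μ H ≤ k * m := by
        refine le_trans ?_ (hE2.trans (le_mul_of_one_le_left' (by exact_mod_cast hk1)))
        gcongr
        exact le_mul_of_one_le_left' one_le_two
      calc N * μ (⋃₀ 𝒢 ∪ H ∪ ⋃₀ 𝒟) ≤ N * (μ (⋃₀ 𝒢) + μ H + μ (⋃₀ 𝒟)) := by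
            gcongr
            exact (measure_union_le _ _).trans (by gcongr; exact measure_union_le _ _)
        _ = N * μ (⋃₀ 𝒢) + N * μ H + N * μ (⋃₀ 𝒟) := by ring
        _ ≤ k * m + k * m + k * m := by
            have hKm : K * m ≤ k * m := by gcongr
            exact add_le_add (add_le_add (hE1.trans hKm) h2) (hE3.trans hKm)
        _ = (3 * k : ℝ≥0) * m := by push_cast; ring
    have h3 : ((3 * k : ℝ≥0) : ℝ≥0∞) ≠ 0 := by
      exact_mod_cast (mul_pos three_pos (zero_lt_one.trans_le hk1)).ne'
    rw [← ENNReal.mul_le_mul_iff_right h3 ENNReal.coe_ne_top]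
    refine le_trans (le_of_eq ?_) h1
    rw [hN, hk]
    push_cast
    ring
  · intro y hy
    have hy' : y ∉ ⋃₀ 𝒢 ∪ H ∪ ⋃₀ 𝒟 := fun h => hy (subset_toMeasurable _ _ h)
    rw [mem_union, mem_union, not_or, not_or] at hy'
    obtain ⟨⟨hy1, hy2⟩, hy3⟩ := hy'
    have havg : ∀ B : 𝓑.balls, y ∈ (B : Set X) → avg g (B : Set X) ≤ N * l := by
      intro B hB
      by_contra! hcon
      exact hy1 ⟨B, ⟨B.2, hcon⟩, hB⟩
    have hkN : (N : ℝ≥0∞) ≤ excLevel K := by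
      rw [hexc]
      have : 1 ≤ 5 * k := one_le_mul (by norm_num) hk1
      exact_mod_cast le_mul_of_one_le_left' this
    have hTg : ∀ z ∉ H, ‖T g z‖ₑ ≤ 2 * N * (τ * l) := by
      intro z hz
      by_contra! hcon
      exact hz (subset_toMeasurable _ _ (by push_cast; exact hcon))
    refine ⟨(hTg y hy2).trans ?_, fun B hB => ⟨?_, (havg B hB).trans (by gcongr)⟩⟩
    · have h5 : 2 * N ≤ excLevel K := by
        rw [hexc]
        have : 2 ≤ 5 * k := le_trans (by norm_num) (mul_le_mul_right hk1 5)
        gcongr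
      calc 2 * (N : ℝ≥0∞) * (τ * l) = ((2 * N : ℝ≥0) : ℝ≥0∞) * τ * l := by push_cast; ring
        _ ≤ _ := by gcongr
    by_contra! hcon
    have hstar : 𝓑.avgStar g B ≤ N * l := iSup₂_le fun A hA => havg A (hA hB)
    -- the part of `B` where the local part `T (g 1_{B*})` is large
    set U : Set X := {x | ((2 * k * N * (τ * l) : ℝ≥0) : ℝ≥0∞) <
      ‖T (cutoff g (𝓑.measurableSet_hull B)) x‖ₑ} with hU
    have hUμ : 2 * μ U ≤ μ (B : Set X) := by
      have h := rpow_mul_measure_le hr hweak (cutoff g (𝓑.measurableSet_hull B))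
        (s := 2 * k * N * (τ * l))
        (mul_pos (mul_pos (mul_pos two_pos (zero_lt_one.trans_le hk1)) hN0)
          (mul_pos hτ (pos_iff_ne_zero.2 hl)))
      rw [← hU, energy_cutoff hr, inter_univ] at h
      have h2 : energy g (𝓑.hull B : Set X) ≤ (N * l : ℝ≥0∞) ^ (r : ℝ) * (k * μ (B : Set X)) :=
        ((avg_le_iff hr g (𝓑.measure_coe_pos _).ne' (𝓑.measure_coe_ne_top _) _).1
          (havg _ (𝓑.self_subset_hull B hB))).trans
          (by gcongr; exact (𝓑.measure_hull_le B).trans (by gcongr))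
      have h3 : (2 * k : ℝ≥0∞) * μ U ≤ k * μ (B : Set X) := by
        have hk1' : (1 : ℝ≥0∞) ≤ k := by exact_mod_cast hk1
        have hN0' : (N : ℝ≥0∞) ≠ 0 := by exact_mod_cast hN0.ne'
        refine mul_le_of_rpow_mul_le (s := τ * (N * l)) hr (one_le_mul one_le_two hk1')
          (mul_ne_zero hτ0 (mul_ne_zero hN0' hl0)) (by finiteness) ?_
        calc _ = ((2 * k * N * (τ * l) : ℝ≥0) : ℝ≥0∞) ^ (r : ℝ) * μ U := by
              congr 2; push_cast; ring
          _ ≤ _ := h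
          _ ≤ (τ : ℝ≥0∞) ^ (r : ℝ) * ((N * l : ℝ≥0∞) ^ (r : ℝ) * (k * μ (B : Set X))) := by gcongr
          _ = _ := by
              rw [ENNReal.mul_rpow_of_nonneg (τ : ℝ≥0∞) _ (coe_pos hr).le, mul_assoc]
      have hk0 : (k : ℝ≥0∞) ≠ 0 := by exact_mod_cast (zero_lt_one.trans_le hk1).ne'
      rw [← ENNReal.mul_le_mul_iff_right hk0 ENNReal.coe_ne_top]
      exact le_trans (le_of_eq (by ring)) h3
    have hsub : (B : Set X) ⊆ ((B : Set X) ∩ H) ∪ U := by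
      intro z hz
      by_contra hzn
      rw [mem_union, not_or] at hzn
      have hzH : z ∉ H := fun h => hzn.1 ⟨hz, h⟩
      have hzU : ‖T (cutoff g (𝓑.measurableSet_hull B)) z‖ₑ ≤ 2 * k * N * (τ * l) := by
        have : ¬ _ := hzn.2
        rw [hU, mem_ofPred_eq, not_lt] at this
        exact_mod_cast this
      refine absurd hcon (not_lt.2 ?_)
      calc _ ≤ ‖T (cutoff g (𝓑.measurableSet_hull B).compl) z‖ₑ + τ * 𝓑.avgStar g B :=
            𝓑.enorm_sub_le_mul_avgStar hloc g B
              (ne_top_of_le_ne_top (by finiteness) hstar) hB hz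
        _ ≤ (‖T g z‖ₑ + ‖T (cutoff g (𝓑.measurableSet_hull B)) z‖ₑ) + τ * (N * l) := by
            gcongr
            exact hT.enorm_le_add_of_add_eq (cutoff_add_cutoff_compl g _) z
        _ ≤ (2 * N * (τ * l) + 2 * k * N * (τ * l)) + τ * (N * l) := by
            gcongr
            exact hTg z hzH
        _ = ((3 + 2 * k) * N : ℝ≥0) * τ * l := by push_cast; ring
        _ ≤ excLevel K * τ * l := by
            have : 3 + 2 * k ≤ 5 * k := by
              calc 3 + 2 * k ≤ 3 * k + 2 * k := by gcongr; exact le_mul_of_one_le_right' hk1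
                _ = 5 * k := by ring
            rw [hexc]
            gcongr
    refine hy3 ⟨B, ⟨B.2, ?_⟩, hB⟩
    have h1 : μ (B : Set X) ≤ μ ((B : Set X) ∩ H) + μ U :=
      (measure_mono hsub).trans (measure_union_le _ _)
    have h2 : μ (B : Set X) + μ (B : Set X) ≤ 2 * μ ((B : Set X) ∩ H) + μ (B : Set X) := by
      calc μ (B : Set X) + μ (B : Set X) = 2 * μ (B : Set X) := (two_mul _).symm
        _ ≤ 2 * (μ ((B : Set X) ∩ H) + μ U) := by gcongr
        _ = 2 * μ ((B : Set X) ∩ H) + 2 * μ U := mul_add _ _ _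
        _ ≤ _ := by gcongr
    exact (ENNReal.add_le_add_iff_right (𝓑.measure_coe_ne_top _)).1 h2

end Exceptional

/-! ### Domination along chains of balls -/

section Domination

variable {X : Type*} [MeasurableSpace X] {μ : Measure X} {K r : ℝ≥0} {T : Lp ℝ r μ → X → ℝ}

/-- Passage from a large set `V` to the smaller set `hull A ∩ hull D`: if some point `y` of the ball
`D ⊇ A` is not exceptional for `f 1_V`, then on `A` the operator changes only by a multiple of the
level `l`. The part of `f` in `V` outside of `hull D` is transported from `y` by the localization
property, the part in the ring `hull D \ hull A` is controlled by the connectivity property. -/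
theorem BallBasis.enorm_cutoff_le_add (𝓑 : BallBasis μ K) (hr : 1 ≤ r) (hT : IsSubadditiveOp T)
    {τ : ℝ≥0} (hloc : 𝓑.locConst T ≤ τ) (f : Lp ℝ r μ) {V : Set X} (hV : MeasurableSet V)
    {A D : 𝓑.balls} (hring : 𝓑.ringConst T A D ≤ (2 * τ : ℝ≥0)) (hDV : (𝓑.hull D : Set X) ⊆ V)
    {c l : ℝ≥0} {x y : X} (hxA : x ∈ (A : Set X)) (hxD : x ∈ (D : Set X)) (hyD : y ∈ (D : Set X))
    (hy : ∀ B : 𝓑.balls, y ∈ (B : Set X) →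
      ‖T (cutoff (cutoff f hV) (𝓑.measurableSet_hull B).compl) y‖ₑ ≤ c * τ * l ∧
        avg (cutoff f hV) (B : Set X) ≤ c * l) :
    ‖T (cutoff f hV) x‖ₑ ≤ 4 * c * τ * l +
      ‖T (cutoff f ((𝓑.measurableSet_hull A).inter (𝓑.measurableSet_hull D))) x‖ₑ := by
  set g := cutoff f hV with hg
  have hmA := 𝓑.measurableSet_hull A
  have hmD := 𝓑.measurableSet_hull D
  have hstar : 𝓑.avgStar g D ≤ c * l := iSup₂_le fun A' hA' => (hy A' (hA' hyD)).2
  have hsplit : cutoff g hmD = cutoff f (hmA.inter hmD) + cutoff f (hmD.diff hmA) := by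
    rw [hg, cutoff_cutoff, ← cutoff_union f _ _
      (disjoint_left.2 fun z hz hz' => hz'.2 hz.1)]
    refine cutoff_congr f _ _ ?_
    rw [inter_eq_right.2 hDV, inter_comm, inter_union_sdiff]
  have hfar : ‖T (cutoff g hmD.compl) x‖ₑ ≤ c * τ * l + τ * (c * l) :=
    (𝓑.enorm_sub_le_mul_avgStar hloc g D (ne_top_of_le_ne_top (by finiteness) hstar) hxD hyD).trans
      (add_le_add (hy D hyD).1 (mul_le_mul_right hstar _))
  have hnear : ‖T (cutoff f (hmD.diff hmA)) x‖ₑ ≤ (2 * τ : ℝ≥0) * (c * l) := by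
    refine (𝓑.enorm_ring_le hr hring f hxA).trans (mul_le_mul_right ?_ _)
    rw [← avg_cutoff_of_subset hr f hV hDV]
    exact (hy _ (𝓑.self_subset_hull D hyD)).2
  calc ‖T g x‖ₑ = ‖T (cutoff g hmD + cutoff g hmD.compl) x‖ₑ := by rw [cutoff_add_cutoff_compl]
    _ ≤ ‖T (cutoff g hmD) x‖ₑ + ‖T (cutoff g hmD.compl) x‖ₑ := hT.enorm_add_le _ _ _
    _ ≤ (‖T (cutoff f (hmA.inter hmD)) x‖ₑ + (2 * τ : ℝ≥0) * (c * l)) +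
          (c * τ * l + τ * (c * l)) := by
        refine add_le_add ?_ hfar
        rw [hsplit]
        exact (hT.enorm_add_le _ _ _).trans (add_le_add le_rfl hnear)
    _ = _ := by push_cast; ring

/-- A sum over the values of `φ` is bounded by the sum over all indices if no value is taken more
than `M` times. -/
theorem tsum_comp_le_mul_tsum {ι β : Type*} (φ : ι → β) (v : β → ℝ≥0∞) {M : ℝ≥0∞}
    (hM : ∀ b, ∑' i, (φ ⁻¹' {b}).indicator 1 i ≤ M) : ∑' i, v (φ i) ≤ M * ∑' b, v b := by
  classical
  calc ∑' i, v (φ i) = ∑' i, ∑' b, v b * (φ ⁻¹' {b}).indicator 1 i := by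
        refine tsum_congr fun i => ?_
        rw [tsum_eq_single (φ i) fun b hb => ?_]
        · simp
        · simp [hb.symm]
    _ = ∑' b, v b * ∑' i, (φ ⁻¹' {b}).indicator 1 i := by
        rw [ENNReal.tsum_comm]
        exact tsum_congr fun b => ENNReal.tsum_mul_left
    _ ≤ ∑' b, v b * M := by gcongr with b; exact hM b
    _ = M * ∑' b, v b := by rw [ENNReal.tsum_mul_right, mul_comm]

/-- Sets `Z j` with disjoint parts `F j` of proportional measure take any value boundedly often. -/
theorem tsum_indicator_fiber_le {ι : Type*} [Countable ι] {Z F : ι → Set X}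
    (hFm : ∀ j, MeasurableSet (F j)) (hFZ : ∀ j, F j ⊆ Z j) {M : ℝ≥0∞}
    (hZF : ∀ j, μ (Z j) ≤ M * μ (F j)) (hF : Pairwise (Function.onFun Disjoint F)) {W : Set X}
    (h0 : μ W ≠ 0) (hfin : μ W ≠ ∞) : ∑' j, (Z ⁻¹' {W}).indicator 1 j ≤ M := by
  rw [← ENNReal.mul_le_mul_iff_left h0 hfin, ← ENNReal.tsum_mul_right]
  set G : ι → Set X := fun j => {x | x ∈ F j ∧ Z j = W} with hG
  have hGF : ∀ j, G j ⊆ F j := fun j x hx => hx.1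
  have hGm : ∀ j, MeasurableSet (G j) := fun j => (hFm j).inter (MeasurableSet.const _)
  calc ∑' j, (Z ⁻¹' {W}).indicator 1 j * μ W ≤ ∑' j, M * μ (G j) := by
        refine ENNReal.tsum_le_tsum fun j => ?_
        by_cases h : Z j = W
        · have : G j = F j := by ext x; simp [hG, h]
          simpa [h, this] using h ▸ hZF j
        · simp [h]
    _ = M * μ (⋃ j, G j) := by
        rw [ENNReal.tsum_mul_left, measure_iUnion (fun i j hij =>
          (hF hij).mono (hGF i) (hGF j)) hGm]
    _ ≤ M * μ W := by
        gcongr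
        exact iUnion_subset fun j x hx => hx.2 ▸ hFZ j hx.1

theorem isSparse_singleton {γ : ℝ≥0} (hγ : γ ≤ 1) {R : Set X} (hR : MeasurableSet R) :
    IsSparse μ γ {R} := by
  refine ⟨id, fun B hB => ?_, pairwiseDisjoint_singleton _ _⟩
  rw [mem_singleton_iff.1 hB]
  exact ⟨hR, Subset.rfl, mul_le_of_le_one_left' (by exact_mod_cast hγ)⟩

theorem isSparse_range {ι : Type*} {γ : ℝ≥0} {Z F : ι → Set X}
    (hFm : ∀ j, MeasurableSet (F j)) (hFZ : ∀ j, F j ⊆ Z j) (hZF : ∀ j, γ * μ (Z j) ≤ μ (F j))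
    (hF : Pairwise (Function.onFun Disjoint F)) : IsSparse μ γ (range Z) := by
  classical
  have hsel : ∀ W : Set X, ∃ G : Set X, ∀ h : W ∈ range Z, G = F h.choose := fun W => by
    by_cases h : W ∈ range Z
    · exact ⟨F h.choose, fun _ => rfl⟩
    · exact ⟨∅, fun h' => absurd h' h⟩
  choose G hG using hsel
  refine ⟨G, fun W hW => ?_, fun W hW W' hW' hne => ?_⟩
  · have hc := hW.choose_spec
    rw [hG W hW]
    refine ⟨hFm _, (hFZ _).trans hc.le, ?_⟩
    have := hZF hW.choose
    rwa [hc] at this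
  · rw [Function.onFun, hG W hW, hG W' hW']
    refine hF fun h => hne ?_
    rw [← hW.choose_spec, ← hW'.choose_spec, h]

/-- The sparse domination, with `τ` a bound for the constants of the operator. The first sparse
collection consists of the root `R` alone, the second one of the third hulls of the selected balls.
The factor `2 τ` leaves room for the infimum in `connConst`, which need not be attained. -/
theorem BallBasis.exists_sparse_domination (𝓑 : BallBasis μ K) (hr : 1 ≤ r)
    (hT : IsSubadditiveOp T) {τ : ℝ≥0} (hτ : 0 < τ) (hloc : 𝓑.locConst T ≤ τ)
    (hconn : 𝓑.connConst T < (2 * τ : ℝ≥0)) (hweak : weakNorm T ≤ τ) (f : Lp ℝ r μ)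
    (B : 𝓑.balls) {γ : ℝ≥0} (hγ : γ * (4 * (K + 1) ^ 3) ≤ 1) :
    ∃ 𝓢₁ 𝓢₂ : Set (Set X), 𝓢₁ ∪ 𝓢₂ ⊆ 𝓑.balls ∧ IsSparse μ γ 𝓢₁ ∧ IsSparse μ γ 𝓢₂ ∧
      ∀ᵐ x ∂μ, x ∈ (B : Set X) → ‖T f x‖ₑ ≤
        4 * excLevel K * (2 + 4 * (K + 1) ^ 3) * τ * sparseOp (𝓢₁ ∪ 𝓢₂) f x := by
  set c := excLevel K with hc
  set k : ℝ≥0 := K + 1 with hk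
  have hk1 : 1 ≤ k := le_add_of_nonneg_left zero_le
  have hKk : (K : ℝ≥0∞) ≤ k := by exact_mod_cast le_add_of_nonneg_right zero_le
  have hk0 : ((k ^ 3 : ℝ≥0) : ℝ≥0∞) ≠ 0 := by
    exact_mod_cast (pow_pos (zero_lt_one.trans_le hk1) 3).ne'
  -- the second and the third hull
  set h₂ : 𝓑.balls → 𝓑.balls := fun A => 𝓑.hull (𝓑.hull A) with hh₂
  set h₃ : 𝓑.balls → 𝓑.balls := fun A => 𝓑.hull (h₂ A) with hh₃
  have hsub₂ : ∀ A, (𝓑.hull A : Set X) ⊆ h₂ A := fun A => 𝓑.self_subset_hull _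
  have hsub₃ : ∀ A, (h₂ A : Set X) ⊆ h₃ A := fun A => 𝓑.self_subset_hull _
  have hμ₃ : ∀ A, μ (h₃ A : Set X) ≤ (k ^ 3 : ℝ≥0) * μ (A : Set X) := by
    intro A
    calc μ (h₃ A : Set X) ≤ K * (K * (K * μ (A : Set X))) :=
          (𝓑.measure_hull_le _).trans (by
            gcongr
            exact (𝓑.measure_hull_le _).trans (by gcongr; exact 𝓑.measure_hull_le _))
      _ ≤ k * (k * (k * μ (A : Set X))) := by gcongr
      _ = (k ^ 3 : ℝ≥0) * μ (A : Set X) := by push_cast; ring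
  -- the balls provided by the connectivity property
  have hD : ∀ A : 𝓑.balls, ∃ D : 𝓑.balls, (h₃ A : Set X) ≠ univ →
      (h₂ A : Set X) ⊂ D ∧ 𝓑.ringConst T (h₂ A) D ≤ (2 * τ : ℝ≥0) := by
    intro A
    by_cases h : (h₃ A : Set X) = univ
    · exact ⟨A, fun h' => absurd h h'⟩
    · obtain ⟨L, hL, hlt⟩ := sInf_lt_iff.1 hconn
      obtain ⟨D, hD₁, hD₂⟩ := hL (h₂ A) h
      exact ⟨D, fun _ => ⟨hD₁, hD₂.trans hlt.le⟩⟩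
  choose D hD using hD
  -- the truncations of `f` and their exceptional sets; the truncation attached to `A` lives on the
  -- set `V A = h₃ A ∩ hull (D A)`, which depends on `A` alone and not on the chain leading to `A`
  have hVm : ∀ A, MeasurableSet ((h₃ A : Set X) ∩ 𝓑.hull (D A)) := fun A =>
    (𝓑.measurableSet_coe _).inter (𝓑.measurableSet_coe _)
  set l : 𝓑.balls → ℝ≥0 := fun A => (avg f (h₃ A : Set X)).toNNReal with hl
  have hl' : ∀ A, (l A : ℝ≥0∞) = avg f (h₃ A : Set X) := fun A =>
    ENNReal.coe_toNNReal (avg_ne_top hr f (𝓑.measure_coe_pos _).ne')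
  choose E hEm hEμ hE using fun A : 𝓑.balls =>
    𝓑.exists_exceptional_set hr hT hτ hloc hweak (cutoff f (hVm A)) (l A)
      (𝓑.measure_coe_ne_top (h₃ A)) (by
        rw [energy_cutoff hr, inter_univ, hl',
          ← energy_eq_avg hr f (𝓑.measure_coe_pos _).ne' (𝓑.measure_coe_ne_top _)]
        exact energy_mono f inter_subset_left)
  have hEμ' : ∀ A : 𝓑.balls, 4 * μ (E A) ≤ μ (A : Set X) := by
    intro A
    rw [← ENNReal.mul_le_mul_iff_right hk0 ENNReal.coe_ne_top]
    refine le_trans (le_of_eq ?_) ((hEμ A).trans (hμ₃ A))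
    rw [hk]; push_cast; ring
  -- the root of all chains, a ball with half of the energy of `f`
  have hfinν := isFiniteMeasure_withDensity_enorm_rpow hr f
  obtain ⟨R, hBR, hR⟩ :=
    𝓑.exists_ball_half_mass (μ.withDensity fun x => ‖f x‖ₑ ^ (r : ℝ)) B
  rw [withDensity_eq_energy f MeasurableSet.univ,
    withDensity_eq_energy f (𝓑.measurableSet_coe R)] at hR
  have hRfin := avg_ne_top hr f (𝓑.measure_coe_pos R).ne'
  set lR : ℝ≥0 := 2 * (avg f (R : Set X)).toNNReal with hlR
  have hlR' : (lR : ℝ≥0∞) = 2 * avg f (R : Set X) := by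
    rw [hlR]; push_cast; rw [ENNReal.coe_toNNReal hRfin]
  obtain ⟨Z, hZm, hZμ, hZ⟩ := 𝓑.exists_exceptional_set hr hT hτ hloc hweak
    (cutoff f MeasurableSet.univ) lR (𝓑.measure_coe_ne_top R) (by
      rw [cutoff_univ, hlR', ENNReal.mul_rpow_of_nonneg _ _ (coe_pos hr).le, mul_assoc,
        ← energy_eq_avg hr f (𝓑.measure_coe_pos _).ne' (𝓑.measure_coe_ne_top _)]
      refine hR.trans (mul_le_mul_left ?_ _)
      exact ENNReal.le_rpow_self_of_one_le one_le_two (one_le_coe hr))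
  rw [← hc] at hZ
  have hZμ' : 4 * (k ^ 3 : ℝ≥0) * μ Z ≤ μ (R : Set X) := by
    refine le_trans (le_of_eq ?_) hZμ
    rw [hk]; push_cast; ring
  have hZfin : μ Z ≠ ∞ := by
    refine ne_top_of_le_ne_top (𝓑.measure_coe_ne_top R) (le_trans ?_ hZμ')
    refine le_mul_of_one_le_left' (one_le_mul (by norm_num) ?_)
    exact_mod_cast one_le_pow₀ hk1
  obtain ⟨J, A, F, hF, hFdisj, hAZ, hgreedy, hae⟩ :=
    𝓑.exists_greedy_selection E hEm hEμ' hZm hZfin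
  -- a selected ball is so small that its third hull is not the whole space
  have hne : ∀ j, (h₃ (A j) : Set X) ≠ univ := by
    intro j hj
    have h1 : 2 * μ (R : Set X) ≤ μ (R : Set X) := by
      calc 2 * μ (R : Set X) ≤ 2 * μ (h₃ (A j) : Set X) := by
            rw [hj]; gcongr; exact subset_univ _
        _ ≤ 2 * ((k ^ 3 : ℝ≥0) * (2 * μ Z)) := by
            gcongr; exact (hμ₃ _).trans (by gcongr; exact hAZ j)
        _ = 4 * (k ^ 3 : ℝ≥0) * μ Z := by ring
        _ ≤ μ (R : Set X) := hZμ'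
    have h2 : μ (R : Set X) + μ (R : Set X) ≤ 0 + μ (R : Set X) := by
      rwa [zero_add, ← two_mul]
    exact (𝓑.measure_coe_pos R).ne' (le_zero_iff.1
      ((ENNReal.add_le_add_iff_right (𝓑.measure_coe_ne_top R)).1 h2))
  have hDj : ∀ j, (h₂ (A j) : Set X) ⊂ D (A j) := fun j => (hD (A j) (hne j)).1
  have hring : ∀ j, 𝓑.ringConst T (h₂ (A j)) (D (A j)) ≤ (2 * τ : ℝ≥0) :=
    fun j => (hD (A j) (hne j)).2
  -- since `D (A j)` is not contained in the second hull of `A j`, it is larger than the hull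
  have hDlarge : ∀ j, 2 * μ (𝓑.hull (A j) : Set X) < μ (𝓑.hull (D (A j)) : Set X) := by
    intro j
    refine lt_of_lt_of_le ?_ (𝓑.measure_le_measure_hull _)
    by_contra! hle
    refine (hDj j).not_subset (𝓑.subset_hull_of_inter hle ?_)
    obtain ⟨z, hz⟩ := 𝓑.coe_nonempty (𝓑.hull (A j))
    exact ⟨z, (hDj j).subset (hsub₂ _ hz), hz⟩
  set w : X → J → ℝ≥0∞ := fun x j =>
    (h₃ (A j) : Set X).indicator (fun _ => avg f (h₃ (A j) : Set X)) x with hw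
  have hwl : ∀ {x j}, x ∈ (h₃ (A j) : Set X) → w x j = l (A j) := by
    intro x j hx
    rw [hw, hl']
    exact indicator_of_mem hx _
  have hsum : ∀ (x : X) {i j : J}, i < j →
      ∑' n, (Iio i).indicator (w x) n + w x i ≤ ∑' n, (Iio j).indicator (w x) n := by
    classical
    intro x i j hij
    rw [← tsum_ite_eq i (fun _ => w x i), ← ENNReal.tsum_add]
    refine ENNReal.tsum_le_tsum fun n => ?_
    rcases lt_trichotomy n i with h | h | h
    · simp [h, h.ne, h.trans hij]
    · subst h; simp [hij]
    · simp [h.ne', h.le]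
  -- the parents of the selected balls lead back to the root
  have hchain : ∀ j, ∀ x ∈ (h₂ (A j) : Set X), ‖T f x‖ₑ ≤
      4 * c * τ * (lR + ∑' n, (Iio j).indicator (w x) n) + ‖T (cutoff f (hVm (A j))) x‖ₑ := by
    intro j
    induction j using WellFoundedLT.induction with
    | ind j ih =>
    intro x hx
    obtain ⟨y, hyD, hy⟩ := hgreedy j (D (A j)) (hDlarge j)
    have hxD : x ∈ (D (A j) : Set X) := (hDj j).subset hx
    rcases hy with hyZ | ⟨i, hij, hyi, hμi⟩
    · have h1 := 𝓑.enorm_cutoff_le_add hr hT hloc f MeasurableSet.univ (hring j) (subset_univ _)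
        hx hxD hyD (hZ y hyZ).2
      rw [cutoff_univ] at h1
      refine h1.trans ?_
      gcongr
      exact le_self_add
    · have hsub : (𝓑.hull (D (A j)) : Set X) ⊆ h₂ (A i) :=
        𝓑.subset_hull_of_inter hμi ⟨y, 𝓑.self_subset_hull _ hyD, hyi.1⟩
      have hsubV : (𝓑.hull (D (A j)) : Set X) ⊆ (h₃ (A i) : Set X) ∩ 𝓑.hull (D (A i)) :=
        subset_inter (hsub.trans (hsub₃ _))
          (hsub.trans ((hDj i).subset.trans (𝓑.self_subset_hull _)))
      have hxi : x ∈ (h₂ (A i) : Set X) := hsub (𝓑.self_subset_hull _ hxD)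
      have h1 := 𝓑.enorm_cutoff_le_add hr hT hloc f (hVm (A i)) (hring j) hsubV hx hxD hyD
        (hE (A i) y hyi.2).2
      calc ‖T f x‖ₑ ≤ 4 * c * τ * (lR + ∑' n, (Iio i).indicator (w x) n) +
            ‖T (cutoff f (hVm (A i))) x‖ₑ := ih i hij x hxi
        _ ≤ 4 * c * τ * (lR + ∑' n, (Iio i).indicator (w x) n) +
            (4 * c * τ * w x i + ‖T (cutoff f (hVm (A j))) x‖ₑ) := by
            rw [hwl (hsub₃ _ hxi)]
            exact add_le_add le_rfl h1
        _ = 4 * c * τ * (lR + (∑' n, (Iio i).indicator (w x) n + w x i)) +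
            ‖T (cutoff f (hVm (A j))) x‖ₑ := by ring
        _ ≤ _ := by
            gcongr
            exact hsum x hij
  have hF₃ : ∀ j, F j ⊆ (h₃ (A j) : Set X) := fun j =>
    (hF j).2.1.trans ((𝓑.self_subset_hull _).trans ((hsub₂ _).trans (hsub₃ _)))
  have hμF : ∀ j, μ (h₃ (A j) : Set X) ≤ (4 * k ^ 3 : ℝ≥0) * μ (F j) := fun j => by
    calc μ (h₃ (A j) : Set X) ≤ (k ^ 3 : ℝ≥0) * (4 * μ (F j)) :=
          (hμ₃ _).trans (by gcongr; exact (hF j).2.2)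
      _ = (4 * k ^ 3 : ℝ≥0) * μ (F j) := by push_cast; ring
  set Y : J → Set X := fun j => (h₃ (A j) : Set X) with hY
  have hballs : {(R : Set X)} ∪ range Y ⊆ 𝓑.balls := by
    rintro W (hW | ⟨j, rfl⟩)
    · rw [mem_singleton_iff.1 hW]; exact R.2
    · exact (h₃ (A j)).2
  refine ⟨{(R : Set X)}, range Y, hballs, isSparse_singleton ?_ (𝓑.measurableSet_coe R),
    isSparse_range (fun j => (hF j).1) hF₃ (fun j => ?_) hFdisj, ?_⟩
  · refine le_trans (le_mul_of_one_le_right' ?_) hγ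
    exact one_le_mul (by norm_num) (one_le_pow₀ hk1)
  · calc γ * μ (Y j) ≤ γ * ((4 * k ^ 3 : ℝ≥0) * μ (F j)) := by gcongr; exact hμF j
      _ = (γ * (4 * k ^ 3) : ℝ≥0) * μ (F j) := by push_cast; ring
      _ ≤ 1 * μ (F j) := by gcongr; exact_mod_cast hγ
      _ = μ (F j) := one_mul _
  filter_upwards [hae] with x hx hxB
  have hxR : x ∈ (R : Set X) := hBR hxB
  -- the same third hull occurs boundedly often
  have htotal : ∑' j, w x j ≤ (4 * k ^ 3 : ℝ≥0) * sparseOp ({(R : Set X)} ∪ range Y) f x := by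
    refine tsum_comp_le_mul_tsum
      (fun j => (⟨Y j, Or.inr ⟨j, rfl⟩⟩ : ({(R : Set X)} ∪ range Y : Set (Set X))))
      (fun W => (W : Set X).indicator (fun _ => avg f (W : Set X)) x) fun W => ?_
    have h1 := tsum_indicator_fiber_le (W := (W : Set X)) (fun j => (hF j).1) hF₃ hμF hFdisj
      (𝓑.measure_pos _ (hballs W.2)).ne' (𝓑.measure_lt_top _ (hballs W.2)).ne
    refine le_trans (le_of_eq (tsum_congr fun j => ?_)) h1
    simp only [indicator, mem_preimage, mem_singleton_iff, Subtype.ext_iff]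
    rfl
  have hroot : (lR : ℝ≥0∞) ≤ 2 * sparseOp ({(R : Set X)} ∪ range Y) f x := by
    rw [hlR']
    gcongr
    exact le_of_eq_of_le (indicator_of_mem hxR (fun _ => avg f (R : Set X))).symm
      (ENNReal.le_tsum (f := fun W : ({(R : Set X)} ∪ range Y : Set (Set X)) =>
        (W : Set X).indicator (fun _ => avg f (W : Set X)) x) ⟨R, Or.inl rfl⟩)
  suffices h : ‖T f x‖ₑ ≤ 4 * c * τ * (lR + ∑' j, w x j) by
    refine h.trans ((mul_le_mul_right (add_le_add hroot htotal) _).trans (le_of_eq ?_))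
    rw [hk]; push_cast; ring
  by_cases hxZ : x ∈ Z
  · obtain ⟨j, hj⟩ := hx hxZ
    have h1 : ∑' n, (Iio j).indicator (w x) n + w x j ≤ ∑' n, w x n := by
      classical
      rw [← tsum_ite_eq j (fun _ => w x j), ← ENNReal.tsum_add]
      refine ENNReal.tsum_le_tsum fun n => ?_
      rcases lt_trichotomy n j with h | h | h
      · simp [h, h.ne]
      · subst h; simp
      · simp [h.ne', h.le]
    calc ‖T f x‖ₑ ≤ 4 * c * τ * (lR + ∑' n, (Iio j).indicator (w x) n) +
          ‖T (cutoff f (hVm (A j))) x‖ₑ := hchain j x (hsub₂ _ hj.1)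
      _ ≤ 4 * c * τ * (lR + ∑' n, (Iio j).indicator (w x) n) + 4 * c * τ * w x j := by
          gcongr
          rw [hwl (hsub₃ _ (hsub₂ _ hj.1)), mul_assoc 4]
          refine (hE (A j) x hj.2).1.trans ?_
          rw [mul_assoc 4]
          exact le_mul_of_one_le_left' (by norm_num)
      _ = 4 * c * τ * (lR + (∑' n, (Iio j).indicator (w x) n + w x j)) := by ring
      _ ≤ _ := by gcongr
  · have h1 := (hZ x hxZ).1
    rw [cutoff_univ] at h1
    calc ‖T f x‖ₑ ≤ c * τ * lR := h1
      _ ≤ 4 * (c * τ * lR) := le_mul_of_one_le_left' (by norm_num)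
      _ = 4 * c * τ * lR := by ring
      _ ≤ _ := by gcongr; exact le_self_add

/-- An operator of weak type norm zero vanishes almost everywhere. -/
theorem ae_eq_zero_of_weakNorm_eq_zero (hr : 1 ≤ r) (h : weakNorm T = 0) (f : Lp ℝ r μ) :
    ∀ᵐ x ∂μ, T f x = 0 := by
  have hn : ∀ n : ℕ, ∀ᵐ x ∂μ, ‖T f x‖ₑ ≤ ((1 / ((n : ℝ≥0) + 1) : ℝ≥0) : ℝ≥0∞) := by
    intro n
    have hpos : 0 < 1 / ((n : ℝ≥0) + 1) := by positivity
    have h1 := rpow_mul_measure_le (τ := 0) hr h.le f hpos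
    rw [ENNReal.coe_zero, ENNReal.zero_rpow_of_pos (coe_pos hr), zero_mul, le_zero_iff,
      mul_eq_zero] at h1
    have h2 : μ {x | ((1 / ((n : ℝ≥0) + 1) : ℝ≥0) : ℝ≥0∞) < ‖T f x‖ₑ} = 0 := by
      refine h1.resolve_left fun h0 => ?_
      rw [ENNReal.rpow_eq_zero_iff_of_pos (coe_pos hr), ENNReal.coe_eq_zero] at h0
      exact hpos.ne' h0
    filter_upwards [measure_eq_zero_iff_ae_notMem.1 h2] with x hx
    exact not_lt.1 hx
  filter_upwards [ae_all_iff.2 hn] with x hx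
  by_contra h0
  have hpos : 0 < ‖T f x‖₊ := by simpa using h0
  obtain ⟨n, hlt⟩ := exists_nat_one_div_lt (K := ℝ) (NNReal.coe_pos.2 hpos)
  have h2 := hx n
  rw [enorm_eq_nnnorm, ENNReal.coe_le_coe, ← NNReal.coe_le_coe] at h2
  push_cast at h2 hlt
  exact absurd hlt (not_lt.2 h2)

end Domination

theorem theorem1 (K : ℝ≥0) :
    ∃ C γ : ℝ≥0, 0 < C ∧ 0 < γ ∧ γ < 1 ∧
      ∀ (X : Type*) [MeasurableSpace X] (μ : Measure X) (𝓑 : BallBasis μ K)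
        (r : ℝ≥0) (_ : 1 ≤ r) (T : Lp ℝ r μ → X → ℝ)
        (_ : 𝓑.IsBoundedOscillation T) (_ : weakNorm T < ∞)
        (f : Lp ℝ r μ) (B : Set X) (_ : B ∈ 𝓑.balls),
        ∃ 𝓢 𝓢₁ 𝓢₂ : Set (Set X), 𝓢 ⊆ 𝓑.balls ∧ 𝓢 = 𝓢₁ ∪ 𝓢₂ ∧
          IsSparse μ γ 𝓢₁ ∧ IsSparse μ γ 𝓢₂ ∧
          ∀ᵐ x ∂μ, x ∈ B →
            ‖T f x‖ₑ ≤ C * (𝓑.locConst T + 𝓑.connConst T + weakNorm T) * sparseOp 𝓢 f x := by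
  have hk : 1 < 4 * (K + 1) ^ 3 :=
    calc (1 : ℝ≥0) < 4 * 1 ^ 3 := by norm_num
      _ ≤ 4 * (K + 1) ^ 3 := by gcongr; exact le_add_of_nonneg_left zero_le
  refine ⟨4 * excLevel K * (2 + 4 * (K + 1) ^ 3), (4 * (K + 1) ^ 3)⁻¹,
    by rw [excLevel]; positivity, by positivity, inv_lt_one_of_one_lt₀ hk, ?_⟩
  intro X _ μ 𝓑 r hr T hT hweak f B hB
  set s := 𝓑.locConst T + 𝓑.connConst T + weakNorm T with hs
  have hsfin : s ≠ ∞ :=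
    ENNReal.add_ne_top.2 ⟨ENNReal.add_ne_top.2 ⟨hT.localization.ne, hT.connectivity.ne⟩, hweak.ne⟩
  rcases eq_or_ne s 0 with h0 | h0
  · have hw : weakNorm T = 0 := (add_eq_zero.1 h0).2
    refine ⟨∅, ∅, ∅, empty_subset _, (union_empty _).symm, ⟨id, by simp, by simp⟩,
      ⟨id, by simp, by simp⟩, ?_⟩
    filter_upwards [ae_eq_zero_of_weakNorm_eq_zero hr hw f] with x hx _
    simp [hx]
  have hτ : ((s.toNNReal : ℝ≥0) : ℝ≥0∞) = s := ENNReal.coe_toNNReal hsfin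
  have hconn : 𝓑.connConst T < (2 * s.toNNReal : ℝ≥0) := by
    push_cast
    rw [hτ, two_mul]
    refine lt_of_le_of_lt ?_ (ENNReal.lt_add_right hsfin h0)
    exact le_add_self.trans le_self_add
  obtain ⟨𝓢₁, 𝓢₂, hsub, h₁, h₂, hdom⟩ :=
    BallBasis.exists_sparse_domination 𝓑 hr hT.subadditive
      (ENNReal.toNNReal_pos h0 hsfin) (by rw [hτ]; exact le_self_add.trans le_self_add) hconn
      (by rw [hτ]; exact le_add_self) f ⟨B, hB⟩ (γ := (4 * (K + 1) ^ 3)⁻¹)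
      (inv_mul_cancel₀ (zero_lt_one.trans hk).ne').le
  refine ⟨𝓢₁ ∪ 𝓢₂, 𝓢₁, 𝓢₂, hsub, rfl, h₁, h₂, ?_⟩
  filter_upwards [hdom] with x hx hxB
  have := hx hxB
  rw [hτ] at this
  exact_mod_cast this
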